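/- **Setting.** Let $k$ be a commutative ring and $\mathfrak a$ a graded $k$-quiver: a collection of objects with $\mathbb Z$-graded $k$-modules $\mathfrak a(A,A')$. Let $\Sigma$ be the shift, $(\Sigma^sV)^e=V^{e+s}$. The Hochschild object is $\mathbf C(\mathfrak a)=\Sigma^{-1}\mathbf C_{br}(\mathfrak a)$, where $\mathbf C_{br}(\mathfrak a)=\prod_{n\ge0}\prod_{A_0,\dots,A_n}[\Sigma\mathfrak a(A_{n-1},A_n)\otimes\cdots\otimes\Sigma\mathfrak a(A_0,A_1),\Sigma\mathfrak a(A_0,A_n)]$ is a brace algebra under $$\phi\{\phi_1,\dots,\phi_r\}=\sum\phi(1\otimes\cdots\otimes\phi_1\otimes1\otimes\cdots\otimes\phi_r\otimes1\otimes\cdots\otimes1)$$ with Koszul signs. Thus $\mathbf C^{p+1}(\mathfrak a)=\mathbf C_{br}^{p}(\mathfrak a)$; braces and signs are always those of $\mathbf C_{br}$. An $A_{[0,\infty[}$-structure on $\mathfrak a$ is an element $\mu\in\mathbf C^2(\mathfrak a)=\mathbf C^1_{br}(\mathfrak a)$ with $\mu\{\mu\}=0$. It is a cdg structure if its components $\mu_n$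 of arity $n$ vanish for $n\ge3$, and a dg structure if moreover $\mu_0=0$. An $A_{[0,\infty[}$-structure $\mu$ makes $\mathbf C(\mathfrak a)$ a $B_\infty$-algebra, with the braces and the operations $D_1(\phi)=\mu\{\phi\}-(-1)^{|\phi|}\phi\{\mu\}$ ($|\phi|$ the degree in $\mathbf C_{br}$) and $D_n(\phi_1,\dots,\phi_n)=\mu\{\phi_1,\dots,\phi_n\}$ for $n>1$. A $B_\infty$-morphism is a graded $k$-linear map of degree $0$ commuting with all braces and all $D_n$. **Twisted objects.** An object of $\mathsf{Tw_{free}}(\mathfrak a)$ is a pair $(M,\delta_M)$ of a formal coproduct $M=\bigoplus_{i\in I}\Sigma^{m_i}A_i$ ($I$ an arbitrary set, $m_i\in\mathbb Z$, $A_i\in\mathfrak a$) and an element $\delta_M$ of degree $1$ of $\mathrm{Hom}(M,M)$, where $\mathrm{Hom}(M,N)=\prod_i\bigoplus_j\Sigma^{n_j-m_i}\mathfrak a(A_i,B_j)$ for $N=\bigoplus_{j}\Sigma^{n_j}B_j$; these $\mathrm{Hom}$'s are the morphisms of $\mathsf{Tw_{free}}(\mathfrak a)$. Let $\mathsf{Tw}(\mathfrak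 a)$ be the full subquiver on some collection of such objects, and let $\delta\in\mathbf C^1(\mathsf{Tw}(\mathfrak a))$ be the arity-zero cochain with components $\delta_M$. A cochain $\phi\in\mathbf C(\mathfrak a)$ is also regarded as a cochain on $\mathsf{Tw}(\mathfrak a)$ by the matrix formula $$\phi(f_n,\dots,f_1)_{ji}=\sum_{k_1,\dots,k_{n-1}}\pm\,\phi((f_n)_{jk_{n-1}},\dots,(f_1)_{k_1i}),$$ with the Koszul signs of the canonical isomorphisms $[\bigotimes_l\mathfrak a(A_{l-1},A_l),\mathfrak a(A_0,A_n)]\cong[\bigotimes_l\Sigma^{s_l}\mathfrak a(A_{l-1},A_l),\Sigma^{\sum s_l}\mathfrak a(A_0,A_n)]$. Suppose that every $\mathfrak a(A,A')^d$ is a Hausdorff topological $k$-module (addition, negation and multiplication by each scalar are continuous), for instance a discrete one. From here on $\mathbf C(\mathfrak a)$ denotes the cochains on $\mathfrak a$ all of whose multilinear components are continuous; these are all cochains if $\mathfrak a$ is discrete. No continuity is required of the cochains in $\mathbf C(\mathsf{Tw}(\mathfrak a))$. Assume that $\mathsf{Tw}(\mathfrak a)$ is a quiver of twisted objects: for all homogeneous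 $\phi\in\mathbf C(\mathfrak a)$, all composable homogeneous $(f_n,\dots,f_1)$ in $\mathsf{Tw}(\mathfrak a)$ and every index $i$ of the source of $f_1$ (of the object at which the cochain is evaluated, if $n=0$), the $i$-th columns of $\phi\{\delta^{\otimes m}\}(f_n,\dots,f_1)$, $m\ge0$, are supported in a common finite set of row indices and form a series that converges entrywise. For discrete $\mathfrak a$ this says that the $i$-th column of $\phi\{\delta^{\otimes m}\}(f_n,\dots,f_1)$ vanishes for all large $m$, i.e. that $\mathsf{Tw}(\mathfrak a)$ is a quiver of locally nilpotent twisted objects. **Proposition.** The pointwise series $$\mathrm{embr}_\delta(\phi)=\sum_{m=0}^\infty\phi\{\delta^{\otimes m}\}$$ defines a map $\mathrm{embr}_\delta:\mathbf C(\mathfrak a)\to\mathbf C(\mathsf{Tw}(\mathfrak a))$, and the following hold. 1. If $\mu\in\mathbf C^2(\mathfrak a)$ is an $A_{[0,\infty[}$-structure on $\mathfrak a$, then $\mathrm{embr}_\delta(\mu)$ is an $A_{[0,\infty[}$-structure on $\mathsf{Tw}(\mathfrak a)$, and $\mathrm{embr}_\delta:\mathbf C(\mathfrak a)\to\mathbf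 C(\mathsf{Tw}(\mathfrak a))$ is a $B_\infty$-morphism for the $B_\infty$-structures determined by $\mu$ and $\mathrm{embr}_\delta(\mu)$. 2. If $\mu=c+d+m\in\mathbf C^2(\mathfrak a)$, with $c,d,m$ of arity $0,1,2$, is a cdg structure on $\mathfrak a$, then $$\mathrm{embr}_\delta(\mu)=(c+d\{\delta\}+m\{\delta,\delta\})+(d+m\{\delta\})+m,$$ the three summands have arity $0$, $1$ and $2$, and this is a cdg structure on $\mathsf{Tw}(\mathfrak a)$. 3. If $\mu=d+m\in\mathbf C^2(\mathfrak a)$, with $d,m$ of arity $1,2$, is a dg structure on $\mathfrak a$ and $d\{\delta\}+m\{\delta,\delta\}=0$ in $\mathbf C(\mathsf{Tw}(\mathfrak a))$, then $\mathrm{embr}_\delta(\mu)=(d+m\{\delta\})+m$, and this is a dg structure on $\mathsf{Tw}(\mathfrak a)$. -/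

import Mathlib

open Filter Topology

universe u v w

namespace TwistedObjects

/-! ### Graded quivers and their Hochschild objects

A graded `k`-quiver is given by a type `Ob` of objects and a family `H A B d` of `k`-modules: the
degree `d` part of the graded object of morphisms from `A` to `B`. All signs are Koszul signs for
the suspended quiver: a morphism `f` in `H A B d`, seen as `σ f`, has degree `d - 1`. -/

section Quiver

variable {Ob : Type u} (H : Ob → Ob → ℤ → Type v)

/-- Composable strings `(f_n, …, f_1)` of homogeneous morphisms `f_i : A_{i-1} → A_i` from `A_0`
to `A_n`. The outermost `cons` carries `f_n`, the leftmost tensor factor. -/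
inductive HPath : Ob → Ob → Type (max u v)
  | nil (A : Ob) : HPath A A
  | cons {A B C : Ob} {d : ℤ} (f : H B C d) (q : HPath A B) : HPath A C

/-- Families of functions sending a string from `A` to `B` to an element of `∏ e, H A B e`.
The Hochschild cochains are singled out among them by `IsCochain`. -/
abbrev RawCochain : Type (max u v) := ∀ A B : Ob, HPath H A B → ∀ e : ℤ, H A B e

variable {H}

namespace HPath

/-- The number of morphisms in a string. -/
def length {A B : Ob} : HPath H A B → ℕ
  | nil _ => 0
  | cons _ q => length q + 1

/-- The degree of `σ f_n ⊗ … ⊗ σ f_1`, which is the sum of the `|f_i| - 1`. -/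
def sdeg {A B : Ob} : HPath H A B → ℤ
  | nil _ => 0
  | @cons _ _ _ _ _ d _ q => (d - 1) + sdeg q

/-- Concatenation: `comp r q` has `r` on the left of `q`. -/
def comp {A B C : Ob} : HPath H B C → HPath H A B → HPath H A C
  | nil _, q => q
  | cons f r, q => cons f (comp r q)

/-- All `n + 1` ways to cut a string of length `n` into a left and a right part. -/
def splits {A B : Ob} : HPath H A B → List (Σ C : Ob, HPath H C B × HPath H A C)
  | nil A => [⟨A, nil A, nil A⟩]
  | cons f q => ⟨_, nil _, cons f q⟩ :: (splits q).map fun s => ⟨s.1, cons f s.2.1, s.2.2⟩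

/-- The string `(f_n, …, f_1)` of a family of morphisms `f_{i+1} : A_i → A_{i+1}`. -/
def ofFn : ∀ (n : ℕ) (A : Fin (n + 1) → Ob) (d : Fin n → ℤ),
    (∀ i : Fin n, H (A i.castSucc) (A i.succ) (d i)) → HPath H (A 0) (A (Fin.last n))
  | 0, A, _, _ => nil (A 0)
  | n + 1, A, d, f => cons (f (Fin.last n))
      (ofFn n (fun i => A i.castSucc) (fun i => d i.castSucc) (fun i => f i.castSucc))

end HPath

/-- `IsCochain k p φ`: `φ` is an element of degree `p` of `C_br(a) = [T(Σ a), Σ a]`, that is, an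
element of degree `p + 1` of the Hochschild object `C(a) = Σ⁻¹ C_br(a)`. It is a family, over all
`A_0, …, A_n` with `n ≥ 0` and all degrees, of `k`-multilinear maps
`a(A_{n-1}, A_n) × … × a(A_0, A_1) → a(A_0, A_n)` of degree `p` with respect to the suspended
degrees. The value in `∏ e, a(A_0, A_n)^e` is concentrated in the one degree `e` with
`e - 1 = ∑ (|f_i| - 1) + p`. -/
structure IsCochain (k : Type*) [CommRing k] [∀ A B d, AddCommGroup (H A B d)]
    [∀ A B d, Module k (H A B d)] (p : ℤ) (φ : RawCochain H) : Prop where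
  eq_zero : ∀ (A B : Ob) (q : HPath H A B) (e : ℤ), e ≠ q.sdeg + p + 1 → φ A B q e = 0
  map_add : ∀ (A B C D : Ob) (r : HPath H C D) (q : HPath H A B) (d : ℤ) (f g : H B C d) (e : ℤ),
    φ A D (r.comp (.cons (f + g) q)) e
      = φ A D (r.comp (.cons f q)) e + φ A D (r.comp (.cons g q)) e
  map_smul : ∀ (A B C D : Ob) (r : HPath H C D) (q : HPath H A B) (d : ℤ) (c : k) (f : H B C d)
    (e : ℤ), φ A D (r.comp (.cons (c • f) q)) e = c • φ A D (r.comp (.cons f q)) e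

/-- `φ` has only a component of arity `n`. -/
def HasArity [∀ A B d, AddCommGroup (H A B d)] (n : ℕ) (φ : RawCochain H) : Prop :=
  ∀ (A B : Ob) (q : HPath H A B), q.length ≠ n → φ A B q = 0

/-- All multilinear components of `φ` are (jointly) continuous. This is no condition when all
`H A B d` are discrete. -/
def IsContinuous [∀ A B d, TopologicalSpace (H A B d)] (φ : RawCochain H) : Prop :=
  ∀ (n : ℕ) (A : Fin (n + 1) → Ob) (d : Fin n → ℤ) (e : ℤ),
    Continuous fun f : ∀ i : Fin n, H (A i.castSucc) (A i.succ) (d i) =>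
      φ _ _ (HPath.ofFn n A d f) e

/-- The continuous Hochschild cochains of degree `p`; for a discrete quiver, all of them. -/
def IsContCochain (k : Type*) [CommRing k] [∀ A B d, AddCommGroup (H A B d)]
    [∀ A B d, Module k (H A B d)] [∀ A B d, TopologicalSpace (H A B d)]
    (p : ℤ) (φ : RawCochain H) : Prop :=
  IsCochain k p φ ∧ IsContinuous φ

/-! ### Braces -/

/-- Apply `ψ.2` (of degree `ψ.1`) to a left part of the string, and `rest` (standing for an
operator of degree `w`) to the remaining right part. -/
def placeLeft (ψ : ℤ × RawCochain H) (w : ℤ)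
    (rest : ∀ A B : Ob, HPath H A B → List (ℤˣ × HPath H A B)) {A B : Ob} (q : HPath H A B) :
    List (ℤˣ × HPath H A B) :=
  q.splits.flatMap fun s => (rest A s.1 s.2.2).map fun x =>
    ((w * s.2.1.sdeg).negOnePow * x.1,
      .cons (ψ.2 s.1 B s.2.1 (s.2.1.sdeg + ψ.1 + 1)) x.2)

/-- Leave a number of morphisms on the left untouched, then proceed as in `placeLeft`. -/
def insertFirst (ψ : ℤ × RawCochain H) (w : ℤ)
    (rest : ∀ A B : Ob, HPath H A B → List (ℤˣ × HPath H A B)) :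
    ∀ {A B : Ob}, HPath H A B → List (ℤˣ × HPath H A B)
  | _, _, .nil A => placeLeft ψ w rest (.nil A)
  | _, _, @HPath.cons _ _ _ _ _ d f q => placeLeft ψ w rest (.cons f q) ++
      (insertFirst ψ w rest q).map fun x => (((ψ.1 + w) * (d - 1)).negOnePow * x.1, .cons f x.2)

/-- The signed strings whose sum is
`∑ (1 ⊗ … ⊗ ψ_1 ⊗ 1 ⊗ … ⊗ ψ_m ⊗ 1 ⊗ … ⊗ 1)(σ f_n ⊗ … ⊗ σ f_1)`. The list consists of pairs (degree,
cochain). The Koszul sign rule says that `ψ_j` picks up `(-1) ^ (|ψ_j| (|f_i| - 1))` for every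
`f_i` on the left of the block to which it is applied. -/
def insertions : List (ℤ × RawCochain H) → ∀ A B : Ob, HPath H A B → List (ℤˣ × HPath H A B)
  | [], _, _, q => [(1, q)]
  | ψ :: ψs, _, _, q => insertFirst ψ (ψs.map Prod.fst).sum (insertions ψs) q

variable [∀ A B d, AddCommGroup (H A B d)]

/-- The brace `φ{ψ_1, …, ψ_m} = ∑ φ(1 ⊗ … ⊗ ψ_1 ⊗ 1 ⊗ … ⊗ ψ_m ⊗ 1 ⊗ … ⊗ 1)`. -/
def brace (φ : RawCochain H) (ψs : List (ℤ × RawCochain H)) : RawCochain H :=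
  fun A B q e => ((insertions ψs A B q).map fun x => x.1 • φ A B x.2 e).sum

/-! ### `A_[0,∞[`-structures and `B_∞`-morphisms -/

/-- `A_[0,∞[`-structures: elements `b` of degree `1` of `C_br(a)` with `b{b} = 0`. -/
def IsAInftyStructure (k : Type*) [CommRing k] [∀ A B d, Module k (H A B d)]
    (b : RawCochain H) : Prop :=
  IsCochain k 1 b ∧ brace b [(1, b)] = 0

/-- Curved dg structures: `b_n = 0` for `n ≥ 3`. -/
def IsCdgStructure (k : Type*) [CommRing k] [∀ A B d, Module k (H A B d)]
    (b : RawCochain H) : Prop :=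
  IsAInftyStructure k b ∧ ∀ (A B : Ob) (q : HPath H A B), 3 ≤ q.length → b A B q = 0

/-- Dg structures: `b_n = 0` for `n ≥ 3` and for `n = 0`. -/
def IsDgStructure (k : Type*) [CommRing k] [∀ A B d, Module k (H A B d)]
    (b : RawCochain H) : Prop :=
  IsCdgStructure k b ∧ ∀ (A B : Ob) (q : HPath H A B), q.length = 0 → b A B q = 0

/-- The operations `D_n` on the Hochschild object determined by `b`: the Hochschild differential
`D_1(φ) = ⟨b, φ⟩ = b{φ} - (-1) ^ |φ| φ{b}` and `D_n(φ_1, …, φ_n) = b{φ_1, …, φ_n}` for `n > 1`. -/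
def opD (b : RawCochain H) : List (ℤ × RawCochain H) → RawCochain H
  | [] => 0
  | [φ] => brace b [φ] - φ.1.negOnePow • brace φ.2 [(1, b)]
  | φs => brace b φs

/-- `F` is a `B_∞`-morphism from the cochains of class `𝒞` on a quiver with
`A_[0,∞[`-structure `b` to the cochains of class `𝒞'` on a quiver with `A_[0,∞[`-structure `b'`:
a graded `k`-linear map that commutes with all braces and with all operations `D_n`.
`F p` is the component of `F` in degree `p`. -/
structure IsBInftyMorphism (k : Type*) [CommRing k] [∀ A B d, Module k (H A B d)]
    {Ob' : Type*} {H' : Ob' → Ob' → ℤ → Type*} [∀ A B d, AddCommGroup (H' A B d)]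
    [∀ A B d, Module k (H' A B d)]
    (𝒞 : ℤ → RawCochain H → Prop) (𝒞' : ℤ → RawCochain H' → Prop)
    (b : RawCochain H) (b' : RawCochain H') (F : ℤ → RawCochain H → RawCochain H') : Prop where
  map_mem : ∀ p φ, 𝒞 p φ → 𝒞' p (F p φ)
  map_add : ∀ p φ ψ, 𝒞 p φ → 𝒞 p ψ → F p (φ + ψ) = F p φ + F p ψ
  map_smul : ∀ p (c : k) φ, 𝒞 p φ → F p (c • φ) = c • F p φ
  map_brace : ∀ p φ (ψs : List (ℤ × RawCochain H)), 𝒞 p φ → (∀ ψ ∈ ψs, 𝒞 ψ.1 ψ.2) →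
    F (p + (ψs.map Prod.fst).sum) (brace φ ψs)
      = brace (F p φ) (ψs.map fun ψ => (ψ.1, F ψ.1 ψ.2))
  map_opD : ∀ φs : List (ℤ × RawCochain H), (∀ φ ∈ φs, 𝒞 φ.1 φ.2) →
    F (1 + (φs.map Prod.fst).sum) (opD b φs) = opD b' (φs.map fun φ => (φ.1, F φ.1 φ.2))

end Quiver

/-! ### Twisted objects -/

/-- Objects of `Free(a)`: formal coproducts `⊕_{i ∈ I} Σ^{m_i} A_i`. -/
structure FreeObj (Ob : Type u) where
  /-- the index set -/
  I : Type w
  /-- the objects `A_i` -/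
  obj : I → Ob
  /-- the shifts `m_i` -/
  shift : I → ℤ

section Twisted

variable {Ob : Type u} (H : Ob → Ob → ℤ → Type v) [∀ A B d, AddCommGroup (H A B d)]

/-- The degree `e` part `∏_i ⊕_j (Σ^{n_j - m_i} a(A_i, B_j))^e` of `Free(a)(M, N)`; note that
`(Σ^s a(A, B))^e = a(A, B)^{e + s}`. The matrix entry `f_{ji}` is `f i j`. -/
abbrev FreeHom (M N : FreeObj.{u, w} Ob) (e : ℤ) : Type (max v w) :=
  ∀ i : M.I, Π₀ j : N.I, H (M.obj i) (N.obj j) (e + N.shift j - M.shift i)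

/-- Objects `(M, δ_M)` of `Tw_free(a)`, with `δ_M` of degree `1`. -/
structure TwObj extends FreeObj.{u, w} Ob where
  /-- the twisting morphism -/
  δ : FreeHom H toFreeObj toFreeObj 1

variable {H}

/-- The morphisms of the full subquiver of `Tw_free(a)` on a set `T` of objects. -/
abbrev TwHom (T : Set (TwObj.{u, v, w} H)) (M N : T) (e : ℤ) : Type (max v w) :=
  FreeHom H M.1.toFreeObj N.1.toFreeObj e

variable (T : Set (TwObj.{u, v, w} H))

/-- The canonical element `δ` of degree `0` of `C_br`, that is, of degree `1` of `C`: it has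
arity zero and its component at `(M, δ_M)` is `δ_M`. -/
def deltaCochain : RawCochain (TwHom T)
  | _, _, .nil M => Pi.single (M := fun e => TwHom T M M e) 1 M.1.δ
  | _, _, .cons _ _ => 0

open Classical in
/-- The sum of `± G j (f_n)_{j k_{n-1}} … (f_1)_{k_1 i}` over all indices `k_1, …, k_{n-1}` and
`j`, for a string `(f_n, …, f_1)` of matrices and a column index `i`. Only nonzero entries
contribute. The sign is that of moving the shifts `σ^s` of the entries to the left: with
`x_l = σ (f_l)_{k_l k_{l-1}}` and `s_l = m_{k_l} - m_{k_{l-1}}` it is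
`(-1) ^ ∑_l |x_l| (s_1 + … + s_{l-1})`. -/
noncomputable def entrySum {X : Type*} [AddCommGroup X] {M N : T} (i : M.1.I) :
    HPath (TwHom T) M N → (∀ j : N.1.I, HPath H (M.1.obj i) (N.1.obj j) → X) → X
  | .nil _, G => G i (.nil _)
  | @HPath.cons _ _ _ L N d f q, G => entrySum i q fun l r =>
      (f l).sum fun j x =>
        (((d + N.1.shift j - L.1.shift l) - 1) * (L.1.shift l - M.1.shift i)).negOnePow •
          G j (.cons x r)

open Classical in
/-- The image in `C_br(Tw(a))` of a cochain `φ` of degree `p` of `C_br(a)` under the canonical map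
induced by `[⊗ a(A_{l-1}, A_l), a(A_0, A_n)] ≅ [⊗ Σ^{s_l} a(A_{l-1}, A_l), Σ^{∑ s_l} a(A_0, A_n)]`:
`φ(f_n, …, f_1)_{ji} = ∑ ± φ((f_n)_{j k_{n-1}}, …, (f_1)_{k_1 i})`, with the total sign
`(-1) ^ (p ∑ s_l + ∑_l |x_l| (s_1 + … + s_{l-1}))`. -/
noncomputable def extend (p : ℤ) (φ : RawCochain H) : RawCochain (TwHom T) :=
  fun M N q e i => entrySum T i q fun j r =>
    (p * (N.1.shift j - M.1.shift i)).negOnePow •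
      DFinsupp.single j (φ _ _ r (e + N.1.shift j - M.1.shift i))

/-- The list `δ, …, δ` of length `m`. -/
def deltas (m : ℕ) : List (ℤ × RawCochain (TwHom T)) := List.replicate m (0, deltaCochain T)

/-- The term `φ{δ^{⊗ m}}` in `C_br(Tw(a))`. -/
noncomputable def embrTerm (p : ℤ) (φ : RawCochain H) (m : ℕ) : RawCochain (TwHom T) :=
  brace (extend T p φ) (deltas T m)

variable [∀ A B d, TopologicalSpace (H A B d)]

open Classical in
/-- `embr_δ(φ) = ∑_{m ≥ 0} φ{δ^{⊗ m}}`, a pointwise series, for `φ` of degree `p`. -/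
noncomputable def embr (p : ℤ) (φ : RawCochain H) : RawCochain (TwHom T) :=
  fun _ _ q e i => ∑ᶠ j, DFinsupp.single j
    (limUnder atTop fun n => ∑ m ∈ Finset.range n, embrTerm T p φ m _ _ q e i j)

/-- Pointwise convergence of the series `∑ g_m` of cochains to `Φ`. At every string and for every
column index `i`, the columns `g_m(f_n, …, f_1)_{- i}` converge in the direct sum
`⊕_j a(A_i, B_j)`: for a series in a topological direct sum of Hausdorff groups this means that all
terms are supported in one finite set of indices `j` and that every entry converges. -/
def PointwiseHasSum (g : ℕ → RawCochain (TwHom T)) (Φ : RawCochain (TwHom T)) : Prop :=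
  ∀ (M N : T) (q : HPath (TwHom T) M N) (e : ℤ) (i : M.1.I),
    (∃ J : Finset N.1.I, ∀ m, ∀ j ∉ J, g m M N q e i j = 0) ∧
    ∀ j, Tendsto (fun n => ∑ m ∈ Finset.range n, g m M N q e i j) atTop (𝓝 (Φ M N q e i j))

/-- The full subquiver of `Tw_free(a)` on the set of objects `T` is a quiver of twisted objects:
for every continuous cochain `φ` on `a`, the series `∑ φ{δ^{⊗ m}}` converges pointwise. If `a` is
discrete this says that for all `φ`, `(f_n, …, f_1)` and `i`, the column of index `i` of
`φ{δ^{⊗ m}}(f_n, …, f_1)` vanishes for large `m`, i.e. that `T` is a quiver of locally nilpotent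
twisted objects. -/
def IsTwistedQuiver (k : Type*) [CommRing k] [∀ A B d, Module k (H A B d)] : Prop :=
  ∀ (p : ℤ) (φ : RawCochain H), IsContCochain k p φ →
    ∀ (M N : T) (q : HPath (TwHom T) M N) (e : ℤ) (i : M.1.I),
      (∃ J : Finset N.1.I, ∀ m, ∀ j ∉ J, embrTerm T p φ m M N q e i j = 0) ∧
      ∀ j, ∃ x, Tendsto (fun n => ∑ m ∈ Finset.range n, embrTerm T p φ m M N q e i j)
        atTop (𝓝 x)

end Twisted

end TwistedObjects

open TwistedObjects

/-! `φ{δ^{⊗ m}}` sums `φ` over all ways of inserting `m` copies of the arity-zero, degree-zero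
element `δ` into a string, so `embr_δ φ` is `φ` composed with the exponential that inserts any
number of copies. This exponential is compatible with cutting a string into pieces, and a brace is
a signed sum over cuttings; hence `embr_δ` commutes with braces of cochains of bounded arity, where
all sums are finite. For general cochains the two sides are different rearrangements of a
conditionally convergent series. One passes from truncations to the limit by a gliding hump: a
cochain may take its components of different arities from different given cochains, and convergence
of the series for all such selections forces `embr_δ` to be continuous for the filtration by arity.
-/

namespace TwistedObjects

/-! ### Cutting and inserting -/

section Calculus

variable {Ob : Type u} {H : Ob → Ob → ℤ → Type v} {X Y : Type*} [AddCommGroup X] [AddCommGroup Y]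

namespace HPath

variable {A B C : Ob}

@[simp]
theorem length_comp (r : HPath H B C) (q : HPath H A B) :
    (r.comp q).length = r.length + q.length := by
  induction r with
  | nil => simp [comp, length]
  | cons f r ih => simp only [comp, length, ih]; omega

@[simp]
theorem sdeg_comp (r : HPath H B C) (q : HPath H A B) : (r.comp q).sdeg = r.sdeg + q.sdeg := by
  induction r with
  | nil => simp [comp, sdeg]
  | cons f r ih => simp only [comp, sdeg, ih]; ring

theorem comp_assoc {D : Ob} (r : HPath H C D) (q : HPath H B C) (s : HPath H A B) :
    (r.comp q).comp s = r.comp (q.comp s) := by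
  induction r with
  | nil => rfl
  | cons f r ih => simp only [comp, ih]

end HPath

/-- The sum of a function of two strings over all ways to cut a string into two parts. -/
def splitSum {A B : Ob} (F : ∀ C : Ob, HPath H C B → HPath H A C → X) (q : HPath H A B) : X :=
  (q.splits.map fun s => F s.1 s.2.1 s.2.2).sum

/-- The signed sum of a function on strings over all insertions of `ψs` into a string. -/
def insertSum (ψs : List (ℤ × RawCochain H)) {A B : Ob} (G : HPath H A B → X) (q : HPath H A B) :
    X :=
  ((insertions ψs A B q).map fun x => x.1 • G x.2).sum

/-- The summand of `insertSum (ψ :: ψs) G` for the string `(l, m, s)` in which `l` is left alone,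
`ψ` is applied to `m`, and `ψs` are inserted into `s`. -/
def insertTerm (ψ : ℤ × RawCochain H) (ψs : List (ℤ × RawCochain H)) {A B C D : Ob}
    (G : HPath H A B → X) (l : HPath H C B) (m : HPath H D C) (s : HPath H A D) : X :=
  ((ψ.1 + (ψs.map Prod.fst).sum) * l.sdeg + (ψs.map Prod.fst).sum * m.sdeg).negOnePow •
    insertSum ψs (fun t => G (l.comp (.cons (ψ.2 D C m (m.sdeg + ψ.1 + 1)) t))) s

theorem brace_eq_insertSum [∀ A B d, AddCommGroup (H A B d)] (φ : RawCochain H)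
    (ψs : List (ℤ × RawCochain H)) {A B : Ob} (q : HPath H A B) (e : ℤ) :
    brace φ ψs A B q e = insertSum ψs (fun r => φ A B r e) q := rfl

section SplitSum

variable {A B : Ob} (F F' : ∀ C : Ob, HPath H C B → HPath H A C → X) (q : HPath H A B)

theorem splitSum_nil (F : ∀ C : Ob, HPath H C A → HPath H A C → X) :
    splitSum F (.nil A) = F A (.nil A) (.nil A) := by
  simp [splitSum, HPath.splits]

theorem splitSum_cons {C : Ob} {d : ℤ} (F : ∀ D : Ob, HPath H D C → HPath H A D → X)
    (f : H B C d) :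
    splitSum F (.cons f q)
      = F C (.nil C) (.cons f q) + splitSum (fun D r s => F D (.cons f r) s) q := by
  simp [splitSum, HPath.splits, Function.comp_def]

theorem map_splitSum (g : X →+ Y) :
    g (splitSum F q) = splitSum (fun C r s => g (F C r s)) q := by
  simp [splitSum, map_list_sum, Function.comp_def]

theorem splitSum_add :
    splitSum (fun C r s => F C r s + F' C r s) q = splitSum F q + splitSum F' q := by
  simp [splitSum, List.sum_map_add]

theorem splitSum_smul {R : Type*} [DistribSMul R X] (c : R) :
    splitSum (fun C r s => c • F C r s) q = c • splitSum F q :=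
  (map_splitSum F q (DistribSMul.toAddMonoidHom X c)).symm

theorem splitSum_sum {ι : Type*} (S : Finset ι)
    (F : ι → ∀ C : Ob, HPath H C B → HPath H A C → X) :
    splitSum (fun C r s => ∑ a ∈ S, F a C r s) q = ∑ a ∈ S, splitSum (F a) q := by
  classical
  induction S using Finset.induction_on with
  | empty => simp [splitSum]
  | insert a S ha ih => simp only [Finset.sum_insert ha, splitSum_add, ih]

theorem splitSum_zero : splitSum (fun _ _ _ => (0 : X)) q = 0 := by
  simp [splitSum]

variable {F F' q}

theorem splitSum_congr
    (h : ∀ C r s, r.sdeg + s.sdeg = q.sdeg → r.length + s.length = q.length →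
      F C r s = F' C r s) : splitSum F q = splitSum F' q := by
  induction q with
  | nil => simpa [splitSum_nil] using h _ _ _ (by simp [HPath.sdeg]) (by simp [HPath.length])
  | cons f q ih =>
    rw [splitSum_cons, splitSum_cons, h _ _ _ (by simp [HPath.sdeg]) (by simp [HPath.length])]
    congr 1
    refine ih fun C r s h1 h2 => h _ _ _ ?_ ?_
    · simp only [HPath.sdeg]; omega
    · simp only [HPath.length]; omega

theorem splitSum_eq_zero (h : ∀ C r s, r.length + s.length = q.length → F C r s = 0) :
    splitSum F q = 0 :=
  (splitSum_congr fun C r s _ => h C r s).trans (splitSum_zero q)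

end SplitSum

section InsertSum

variable {A B : Ob} (ψ : ℤ × RawCochain H) (ψs : List (ℤ × RawCochain H))
  (G G' : HPath H A B → X) (q : HPath H A B)

@[simp]
theorem insertSum_nil : insertSum [] G q = G q := by
  simp [insertSum, insertions]

theorem map_insertSum (g : X →+ Y) :
    g (insertSum ψs G q) = insertSum ψs (fun r => g (G r)) q := by
  simp [insertSum, map_list_sum, Function.comp_def, Units.smul_def]

theorem insertSum_add :
    insertSum ψs (fun r => G r + G' r) q = insertSum ψs G q + insertSum ψs G' q := by
  simp [insertSum, List.sum_map_add]

theorem insertSum_zero : insertSum ψs (fun _ => (0 : X)) q = 0 := by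
  simp [insertSum]

theorem insertSum_smul {R : Type*} [DistribSMul R X] (c : R) :
    insertSum ψs (fun r => c • G r) q = c • insertSum ψs G q := by
  simp only [insertSum, List.smul_sum, List.map_map, Function.comp_def, smul_comm c]

theorem sum_placeLeft :
    ((placeLeft ψ (ψs.map Prod.fst).sum (insertions ψs) q).map fun x => x.1 • G x.2).sum
      = splitSum (fun _ m s => insertTerm ψ ψs G (.nil B) m s) q := by
  simp only [placeLeft, splitSum, insertTerm, insertSum]
  induction q.splits with
  | nil => rfl
  | cons s l ih =>
    rw [List.flatMap_cons, List.map_append, List.sum_append, ih]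
    simp only [List.map_map, Function.comp_def, List.smul_sum, mul_smul, List.map_cons,
      List.sum_cons, HPath.sdeg, HPath.comp, mul_zero, zero_add]

theorem insertTerm_cons_left {C D E : Ob} {d : ℤ} (G : HPath H A C → X) (f : H B C d)
    (l : HPath H E B) (m : HPath H D E) (s : HPath H A D) :
    insertTerm ψ ψs G (.cons f l) m s
      = ((ψ.1 + (ψs.map Prod.fst).sum) * (d - 1)).negOnePow •
        insertTerm ψ ψs (fun r => G (.cons f r)) l m s := by
  rw [insertTerm, insertTerm, smul_smul, ← Int.negOnePow_add, HPath.sdeg]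
  congr 2
  ring

theorem insertSum_cons :
    insertSum (ψ :: ψs) G q
      = splitSum (fun _ l q' => splitSum (fun _ m s => insertTerm ψ ψs G l m s) q') q := by
  induction q with
  | nil =>
    rw [splitSum_nil, ← sum_placeLeft]
    simp only [insertSum, insertions, insertFirst]
  | cons f q ih =>
    rw [splitSum_cons, ← sum_placeLeft]
    simp only [insertTerm_cons_left, splitSum_smul]
    rw [← ih]
    simp only [insertSum, insertions, insertFirst, List.map_append, List.sum_append, List.map_map,
      Function.comp_def, List.smul_sum, mul_smul]

variable {ψs G G' q}

theorem insertSum_congr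
    (h : ∀ r : HPath H A B, r.sdeg = q.sdeg + (ψs.map Prod.fst).sum →
      r.length ≤ q.length + ψs.length → G r = G' r) :
    insertSum ψs G q = insertSum ψs G' q := by
  induction ψs generalizing A B with
  | nil => simpa using h q (by simp) (by simp)
  | cons ψ ψs ih =>
    rw [insertSum_cons, insertSum_cons]
    refine splitSum_congr fun C l q' hl hl' => splitSum_congr fun D m s hm hm' => ?_
    rw [insertTerm, insertTerm, ih fun t ht ht' => h _ ?_ ?_]
    · simp only [HPath.sdeg_comp, HPath.sdeg, List.map_cons, List.sum_cons]; omega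
    · simp only [HPath.length_comp, HPath.length, List.length_cons]; omega

theorem insertSum_map_congr {α : Type*} {ps : List (ℤ × α)} {Ψ Ψ' : ℤ × α → RawCochain H} {n : ℕ}
    (hn : q.length ≤ n)
    (h : ∀ a ∈ ps, ∀ A B (r : HPath H A B), r.length ≤ n → Ψ a A B r = Ψ' a A B r) :
    insertSum (ps.map fun a => (a.1, Ψ a)) G q = insertSum (ps.map fun a => (a.1, Ψ' a)) G q := by
  induction ps generalizing A B with
  | nil => rfl
  | cons a ps ih =>
    simp only [List.map_cons, insertSum_cons]
    refine splitSum_congr fun C l q' _ hl => splitSum_congr fun D m s _ hm => ?_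
    simp only [insertTerm, List.map_map, Function.comp_def, h a (by simp) D C m (by omega)]
    rw [ih (by omega) fun b hb => h b (List.mem_cons_of_mem a hb)]

end InsertSum

end Calculus

/-! ### Multilinear functions on strings -/

section Multilinear

variable {Ob : Type u} {H : Ob → Ob → ℤ → Type v} [∀ A B d, AddCommGroup (H A B d)]
  {k : Type*} [CommRing k] [∀ A B d, Module k (H A B d)]
  {X Y : Type*} [AddCommGroup X] [AddCommGroup Y] [Module k X] [Module k Y]

/-- `LinRel c q q' q''`: the three strings agree except for one place, where they have morphisms
`f`, `g` and `f + c • g`. -/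
inductive LinRel (c : k) : ∀ {A B : Ob}, HPath H A B → HPath H A B → HPath H A B → Prop
  | head {A B C : Ob} {d : ℤ} (f g : H B C d) (q : HPath H A B) :
      LinRel c (.cons f q) (.cons g q) (.cons (f + c • g) q)
  | tail {A B C : Ob} {d : ℤ} (f : H B C d) {q q' q'' : HPath H A B} (h : LinRel c q q' q'') :
      LinRel c (.cons f q) (.cons f q') (.cons f q'')

/-- A function on the strings from `A` to `B` that is linear in every morphism. -/
def IsMultilin (k : Type*) [CommRing k] [∀ A B d, Module k (H A B d)] [Module k X] {A B : Ob}
    (G : HPath H A B → X) : Prop :=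
  ∀ (c : k) (q q' q'' : HPath H A B), LinRel c q q' q'' → G q'' = G q + c • G q'

namespace LinRel

variable {c : k} {A B C : Ob} {q q' q'' : HPath H A B}

theorem sdeg_eq (h : LinRel c q q' q'') : q.sdeg = q''.sdeg ∧ q'.sdeg = q''.sdeg := by
  induction h with
  | head => simp [HPath.sdeg]
  | tail f _ ih => simp [HPath.sdeg, ih]

theorem comp_left (h : LinRel c q q' q'') (r : HPath H B C) :
    LinRel c (r.comp q) (r.comp q') (r.comp q'') := by
  induction r with
  | nil => exact h
  | cons f r ih => exact .tail f ih

theorem comp_right (h : LinRel c q q' q'') (r : HPath H C A) :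
    LinRel c (q.comp r) (q'.comp r) (q''.comp r) := by
  induction h with
  | head f g q => exact .head f g _
  | tail f _ ih => exact .tail f ih

end LinRel

namespace IsMultilin

variable {A B C D : Ob} {d : ℤ} {G : HPath H A C → X}

theorem comp_left (hG : IsMultilin k G) (r : HPath H B C) : IsMultilin k fun q => G (r.comp q) :=
  fun c _ _ _ h => hG c _ _ _ (h.comp_left r)

theorem comp_right (hG : IsMultilin k G) (q : HPath H A B) : IsMultilin k fun r => G (r.comp q) :=
  fun c _ _ _ h => hG c _ _ _ (h.comp_right q)

theorem cons (hG : IsMultilin k G) (f : H B C d) : IsMultilin k fun r => G (.cons f r) :=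
  hG.comp_left (.cons f (.nil B))

theorem zero : IsMultilin k fun _ : HPath H A C => (0 : X) := fun c _ _ _ _ => by simp

theorem add {G' : HPath H A C → X} (hG : IsMultilin k G) (hG' : IsMultilin k G') :
    IsMultilin k fun r => G r + G' r := fun c _ _ _ h => by
  simp only [hG c _ _ _ h, hG' c _ _ _ h, smul_add]; abel

theorem smul {R : Type*} [DistribSMul R X] [SMulCommClass R k X] (hG : IsMultilin k G) (a : R) :
    IsMultilin k fun r => a • G r := fun c _ _ _ h => by
  simp only [hG c _ _ _ h, smul_add, smul_comm a c]

theorem sdeg_smul (hG : IsMultilin k G) (a : ℤ → ℤˣ) : IsMultilin k fun r => a r.sdeg • G r :=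
  fun c _ _ _ h => by
    beta_reduce
    rw [h.sdeg_eq.1, h.sdeg_eq.2]
    exact hG.smul (a _) c _ _ _ h

theorem map (hG : IsMultilin k G) (g : X →ₗ[k] Y) : IsMultilin k fun r => g (G r) :=
  fun c _ _ _ h => by simp [hG c _ _ _ h]

theorem list_sum {ι : Type*} {S : List ι} {G : ι → HPath H A C → X}
    (hG : ∀ a ∈ S, IsMultilin k (G a)) : IsMultilin k fun r => (S.map fun a => G a r).sum := by
  induction S with
  | nil => simpa using zero
  | cons a S ih =>
    simp only [List.forall_mem_cons] at hG
    simpa using hG.1.add (ih hG.2)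

theorem finset_sum {ι : Type*} (S : Finset ι) {G : ι → HPath H A C → X}
    (hG : ∀ a ∈ S, IsMultilin k (G a)) : IsMultilin k fun r => ∑ a ∈ S, G a r := by
  simpa using list_sum (S := S.toList) fun a ha => hG a (Finset.mem_toList.1 ha)

theorem splitSum {A' B' : Ob} {F : HPath H A C → ∀ E : Ob, HPath H E B' → HPath H A' E → X}
    (hF : ∀ E r s, IsMultilin k fun x => F x E r s) (q : HPath H A' B') :
    IsMultilin k fun x => splitSum (F x) q :=
  list_sum fun _ _ => hF _ _ _

theorem insertSum {A' B' : Ob} {F : HPath H A C → HPath H A' B' → X}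
    (hF : ∀ r, IsMultilin k fun x => F x r) (ψs : List (ℤ × RawCochain H)) (q : HPath H A' B') :
    IsMultilin k fun x => insertSum ψs (F x) q :=
  list_sum fun _ _ => (hF _).smul _

/-- A multilinear function as a linear function of one of the morphisms. -/
def entryLin (hG : IsMultilin k G) (l : HPath H D C) (t : HPath H A B) : H B D d →ₗ[k] X where
  toFun x := G (l.comp (.cons x t))
  map_add' x y := by simpa using hG 1 _ _ _ ((LinRel.head x y t).comp_left l)
  map_smul' c x := by
    have h0 : G (l.comp (.cons (0 : H B D d) t)) = 0 := by
      simpa using hG 1 _ _ _ ((LinRel.head (0 : H B D d) 0 t).comp_left l)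
    simpa [h0] using hG c _ _ _ ((LinRel.head 0 x t).comp_left l)

theorem comp_cons_zero (hG : IsMultilin k G) (l : HPath H D C) (t : HPath H A B) :
    G (l.comp (.cons (0 : H B D d) t)) = 0 :=
  (hG.entryLin l t).map_zero

theorem cons_zero (hG : IsMultilin k G) (q : HPath H A B) : G (.cons (0 : H B C d) q) = 0 :=
  hG.comp_cons_zero (.nil C) q

end IsMultilin

theorem isCochain_iff {p : ℤ} {φ : RawCochain H} : IsCochain k p φ ↔
    (∀ (A B : Ob) (q : HPath H A B) (e : ℤ), e ≠ q.sdeg + p + 1 → φ A B q e = 0) ∧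
    ∀ (A B : Ob) (e : ℤ), IsMultilin k fun q => φ A B q e := by
  refine ⟨fun h => ⟨h.eq_zero, fun A B e c q q' q'' hq => ?_⟩, fun h => ⟨h.1, ?_, ?_⟩⟩
  · suffices hs : ∀ {B} (q q' q'' : HPath H A B), LinRel c q q' q'' → ∀ {D} (r : HPath H B D),
        φ A D (r.comp q'') e = φ A D (r.comp q) e + c • φ A D (r.comp q') e from
      hs _ _ _ hq (.nil _)
    intro B q q' q'' hq
    induction hq with
    | head f g q => intro D r; rw [h.map_add, h.map_smul]
    | tail f _ ih =>
      intro D r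
      simpa only [HPath.comp_assoc, HPath.comp] using ih (r.comp (.cons f (.nil _)))
  · exact fun A B C D r q d f g e => ((h.2 A D e).entryLin r q).map_add f g
  · exact fun A B C D r q d c f e => ((h.2 A D e).entryLin r q).map_smul c f

theorem IsCochain.isMultilin {p : ℤ} {φ : RawCochain H} (h : IsCochain k p φ) (A B : Ob) (e : ℤ) :
    IsMultilin k fun q => φ A B q e := (isCochain_iff.1 h).2 A B e

/-- A function of the two parts of a cut string that is multilinear in each of them. -/
structure IsBimultilin (k : Type*) [CommRing k] [∀ A B d, Module k (H A B d)] [Module k X]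
    {A B : Ob} (F : ∀ C : Ob, HPath H C B → HPath H A C → X) : Prop where
  left : ∀ C s, IsMultilin k fun r => F C r s
  right : ∀ C r, IsMultilin k fun s => F C r s

theorem IsBimultilin.cons {A B C : Ob} {d : ℤ} {F : ∀ D : Ob, HPath H D C → HPath H A D → X}
    (hF : IsBimultilin k F) (f : H B C d) :
    IsBimultilin k fun D (r : HPath H D B) s => F D (.cons f r) s :=
  ⟨fun D s => (hF.left D s).cons f, fun D _ => hF.right D _⟩

theorem IsBimultilin.isMultilin_splitSum {A B : Ob}
    {F : ∀ C : Ob, HPath H C B → HPath H A C → X} (hF : IsBimultilin k F) :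
    IsMultilin k (splitSum F) := by
  intro c q q' q'' h
  induction h with
  | head f g q =>
    have hr : (fun D r s => F D (.cons (f + c • g) r) s)
        = fun D r s => F D (.cons f r) s + c • F D (.cons g r) s :=
      funext fun D => funext fun r => funext fun s => hF.left D s c _ _ _ (.head f g r)
    simp only [splitSum_cons, hr, splitSum_add, splitSum_smul, smul_add]
    rw [show F _ _ (.cons (f + c • g) q) = _ from hF.right _ (.nil _) c _ _ _ (.head f g q)]
    abel
  | tail f h ih =>
    simp only [splitSum_cons, smul_add]
    rw [show F _ _ _ = _ from hF.right _ (.nil _) c _ _ _ (.tail f h),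
      ih (hF.cons f)]
    abel

section InsertTerm

variable {ψ : ℤ × RawCochain H} {ψs : List (ℤ × RawCochain H)} {A B C D : Ob}
  {G : HPath H A B → X}

theorem isMultilin_insertTerm_left (hG : IsMultilin k G) (m : HPath H D C) (s : HPath H A D) :
    IsMultilin k fun l => insertTerm ψ ψs G l m s :=
  (IsMultilin.insertSum (fun t => hG.comp_right (.cons _ t)) ψs s).sdeg_smul
    fun a => ((ψ.1 + (ψs.map Prod.fst).sum) * a + (ψs.map Prod.fst).sum * m.sdeg).negOnePow

theorem IsMultilin.comp_cons_apply (hG : IsMultilin k G) {ψ : RawCochain H} {p : ℤ}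
    (hψ : ∀ e, IsMultilin k fun q => ψ D C q e) (l : HPath H C B) (t : HPath H A D) :
    IsMultilin k fun m => G (l.comp (.cons (ψ D C m (m.sdeg + p + 1)) t)) := fun c q q' q'' h => by
  beta_reduce
  rw [h.sdeg_eq.1, h.sdeg_eq.2]
  exact (hψ _).map (hG.entryLin l t) c _ _ _ h

theorem isMultilin_insertTerm_middle (hψ : ∀ e, IsMultilin k fun q => ψ.2 D C q e)
    (hG : IsMultilin k G) (l : HPath H C B) (s : HPath H A D) :
    IsMultilin k fun m => insertTerm ψ ψs G l m s :=
  (IsMultilin.insertSum (fun t => hG.comp_cons_apply hψ l t) ψs s).sdeg_smul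
    fun a => ((ψ.1 + (ψs.map Prod.fst).sum) * l.sdeg + (ψs.map Prod.fst).sum * a).negOnePow

theorem isBimultilin_insertTerm (hψ : ∀ A B e, IsMultilin k fun q => ψ.2 A B q e)
    (hψs : ∀ {D} {K : HPath H A D → X}, IsMultilin k K → IsMultilin k (insertSum ψs K))
    (hG : IsMultilin k G) (l : HPath H C B) :
    IsBimultilin k fun _ m s => insertTerm ψ ψs G l m s :=
  ⟨fun D s => isMultilin_insertTerm_middle (hψ D C) hG l s,
    fun _ _ => (hψs ((hG.comp_left l).cons _)).smul _⟩

theorem isBimultilin_splitSum_insertTerm (hψ : ∀ A B e, IsMultilin k fun q => ψ.2 A B q e)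
    (hψs : ∀ {D} {K : HPath H A D → X}, IsMultilin k K → IsMultilin k (insertSum ψs K))
    (hG : IsMultilin k G) :
    IsBimultilin k fun _ l q => splitSum (fun _ m s => insertTerm ψ ψs G l m s) q :=
  ⟨fun _ q => .splitSum (fun _ m s => isMultilin_insertTerm_left hG m s) q,
    fun _ l => (isBimultilin_insertTerm hψ hψs hG l).isMultilin_splitSum⟩

theorem isMultilin_insertSum (hψ : ∀ ψ ∈ ψs, ∀ A B e, IsMultilin k fun q => ψ.2 A B q e)
    (hG : IsMultilin k G) : IsMultilin k (insertSum ψs G) := by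
  induction ψs generalizing A B with
  | nil => simpa [IsMultilin] using hG
  | cons ψ ψs ih =>
    rw [List.forall_mem_cons] at hψ
    rw [funext (insertSum_cons ψ ψs G)]
    exact (isBimultilin_splitSum_insertTerm hψ.1 (ih hψ.2) hG).isMultilin_splitSum

end InsertTerm

theorem IsCochain.brace {p : ℤ} {φ : RawCochain H} (hφ : IsCochain k p φ)
    {ψs : List (ℤ × RawCochain H)} (hψ : ∀ ψ ∈ ψs, IsCochain k ψ.1 ψ.2) :
    IsCochain k (p + (ψs.map Prod.fst).sum) (brace φ ψs) := by
  refine isCochain_iff.2 ⟨fun A B q e he => ?_, fun A B e =>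
    isMultilin_insertSum (fun ψ h => (hψ ψ h).isMultilin) (hφ.isMultilin A B e)⟩
  rw [brace_eq_insertSum, ← insertSum_zero ψs q]
  exact insertSum_congr fun r hr _ => hφ.eq_zero _ _ _ _ (by omega)

end Multilinear

/-! ### Vanishing on long strings -/

section Vanishing

variable {Ob : Type u} {H : Ob → Ob → ℤ → Type v} {X : Type*} [AddCommGroup X] {A B C : Ob}

/-- `G` vanishes on all strings of length at least `n`. -/
def VanishesFrom (n : ℕ) (G : HPath H A B → X) : Prop :=
  ∀ q : HPath H A B, n ≤ q.length → G q = 0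

namespace VanishesFrom

variable {n : ℕ}

theorem mono {m : ℕ} {G : HPath H A B → X} (h : VanishesFrom n G) (hm : n ≤ m) :
    VanishesFrom m G := fun q hq => h q (hm.trans hq)

theorem comp_left {G : HPath H A C → X} (h : VanishesFrom n G) (l : HPath H B C) :
    VanishesFrom (n - l.length) fun r => G (l.comp r) :=
  fun q hq => h _ (by rw [HPath.length_comp]; omega)

theorem cons {d : ℤ} {G : HPath H A C → X} (h : VanishesFrom n G) (f : H B C d) :
    VanishesFrom (n - 1) fun r => G (.cons f r) :=
  h.comp_left (.cons f (.nil B))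

end VanishesFrom

variable [∀ A B d, AddCommGroup (H A B d)] {k : Type*} [CommRing k] [∀ A B d, Module k (H A B d)]
  [Module k X] {n N M : ℕ} {ψ : ℤ × RawCochain H} {ψs : List (ℤ × RawCochain H)}
  {G : HPath H A B → X}

theorem insertTerm_eq_zero (hψ : ∀ A B e, VanishesFrom N fun q => ψ.2 A B q e)
    (hψs : ∀ {D n} {K : HPath H A D → X}, IsMultilin k K → VanishesFrom n K →
      VanishesFrom (n + M) (insertSum ψs K))
    (hG : IsMultilin k G) (h : VanishesFrom n G) {C D : Ob} (l : HPath H C B) (m : HPath H D C)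
    (s : HPath H A D) (hq : n + (M + N) ≤ l.length + m.length + s.length) :
    insertTerm ψ ψs G l m s = 0 := by
  suffices hs : insertSum ψs
      (fun t => G (l.comp (.cons (ψ.2 D C m (m.sdeg + ψ.1 + 1)) t))) s = 0 by
    rw [insertTerm, hs, smul_zero]
  by_cases hm : N ≤ m.length
  · simp only [show ψ.2 D C m _ = 0 from hψ D C _ m hm, hG.comp_cons_zero, insertSum_zero]
  by_cases hl : n ≤ l.length
  · rw [← insertSum_zero ψs s]
    exact insertSum_congr fun t _ _ => h _ (by rw [HPath.length_comp]; omega)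
  · exact hψs ((hG.comp_left l).cons _) ((h.comp_left l).cons _) s (by omega)

theorem VanishesFrom.insertSum (hψk : ∀ ψ ∈ ψs, ∀ A B e, VanishesFrom N fun q => ψ.2 A B q e)
    (hG : IsMultilin k G) (h : VanishesFrom n G) :
    VanishesFrom (n + ψs.length * N) (insertSum ψs G) := by
  induction ψs generalizing n A B with
  | nil => simpa [VanishesFrom] using h
  | cons ψ ψs ih =>
    rw [List.forall_mem_cons] at hψk
    intro q hq
    rw [List.length_cons, add_mul, one_mul] at hq
    rw [insertSum_cons]
    exact splitSum_eq_zero fun C l q' hl => splitSum_eq_zero fun D m s hm =>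
      insertTerm_eq_zero hψk.1 (ih hψk.2) hG h l m s (by omega)

end Vanishing

/-! ### Inserting any number of copies of an arity-zero cochain -/

section Exponential

variable {Ob : Type u} {H : Ob → Ob → ℤ → Type v}
  {X Y : Type*} [AddCommGroup X] [AddCommGroup Y]

/-- The morphism of degree `1` at `A` given by an arity-zero cochain of degree `0` of `C_br`. -/
abbrev pointAt (δ : RawCochain H) (A : Ob) : H A A ((HPath.nil A : HPath H A A).sdeg + 0 + 1) :=
  δ A A (.nil A) ((HPath.nil A : HPath H A A).sdeg + 0 + 1)

/-- The sum over all insertions of `m` copies of `δ`, which is meant to have degree `0`. -/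
def insertPow (δ : RawCochain H) (m : ℕ) {A B : Ob} (G : HPath H A B → X) (q : HPath H A B) : X :=
  insertSum (List.replicate m (0, δ)) G q

/-- The sum over all insertions of fewer than `L` copies of `δ`. On functions that vanish on
strings of length at least `L` it does not depend on `L`. -/
def insertExp (δ : RawCochain H) (L : ℕ) {A B : Ob} (G : HPath H A B → X) (q : HPath H A B) : X :=
  ∑ m ∈ Finset.range L, insertPow δ m G q

variable {δ : RawCochain H} {A B C : Ob} {d : ℤ} {L n : ℕ}

section Additive

variable (G G' : HPath H A B → X) (q : HPath H A B)

theorem insertExp_add :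
    insertExp δ L (fun r => G r + G' r) q = insertExp δ L G q + insertExp δ L G' q := by
  simp [insertExp, insertPow, insertSum_add, Finset.sum_add_distrib]

theorem insertExp_zero_fun : insertExp δ L (fun _ => (0 : X)) q = 0 := by
  simp [insertExp, insertPow, insertSum_zero]

theorem insertExp_smul {R : Type*} [DistribSMul R X] (c : R) :
    insertExp δ L (fun r => c • G r) q = c • insertExp δ L G q := by
  simp [insertExp, insertPow, insertSum_smul, Finset.smul_sum]

theorem map_insertExp (g : X →+ Y) :
    g (insertExp δ L G q) = insertExp δ L (fun r => g (G r)) q := by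
  simp [insertExp, insertPow, map_insertSum]

theorem insertExp_list_sum {ι : Type*} (S : List ι) (F : HPath H A B → ι → X) :
    insertExp δ L (fun r => (S.map (F r)).sum) q
      = (S.map fun a => insertExp δ L (fun r => F r a) q).sum := by
  induction S with
  | nil => exact insertExp_zero_fun q
  | cons a S ih => simp only [List.map_cons, List.sum_cons, insertExp_add, ih]

theorem insertExp_splitSum_comm {A' B' : Ob}
    (F : HPath H A B → ∀ D : Ob, HPath H D B' → HPath H A' D → X) (q' : HPath H A' B') :
    insertExp δ L (fun r => splitSum (F r) q') q
      = splitSum (fun D l s => insertExp δ L (fun r => F r D l s) q) q' :=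
  insertExp_list_sum q _ _

theorem insertExp_insertSum_comm {A' B' : Ob} (ψs : List (ℤ × RawCochain H))
    (F : HPath H A B → HPath H A' B' → X) (q' : HPath H A' B') :
    insertExp δ L (fun r => insertSum ψs (F r) q') q
      = insertSum ψs (fun t => insertExp δ L (fun r => F r t) q) q' := by
  simp only [insertSum, insertExp_list_sum, insertExp_smul]

variable {G G' q}

theorem insertExp_congr (h : ∀ r : HPath H A B, r.sdeg = q.sdeg → G r = G' r) :
    insertExp δ L G q = insertExp δ L G' q :=
  Finset.sum_congr rfl fun _ _ => insertSum_congr fun r hr _ => h r (by simpa using hr)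

end Additive

theorem vanishesFrom_insertExp_left {A' B' : Ob} {F : HPath H A B → HPath H A' B' → X}
    (h : ∀ r s, n ≤ r.length → F r s = 0) (hn : n ≤ L) (q : HPath H A' B') :
    VanishesFrom L fun r => insertExp δ L (F r) q := fun r hr => by
  rw [← insertExp_zero_fun (δ := δ) (L := L) q]
  exact insertExp_congr fun s _ => h r s (hn.trans hr)

theorem insertPow_zero (G : HPath H A B → X) (q : HPath H A B) : insertPow δ 0 G q = G q :=
  insertSum_nil G q

variable [∀ A B d, AddCommGroup (H A B d)] {k : Type*} [CommRing k] [∀ A B d, Module k (H A B d)]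
  [Module k X] {G : HPath H A B → X}

theorem insertPow_succ (hδ : HasArity 0 δ) (hG : IsMultilin k G) (m : ℕ) (q : HPath H A B) :
    insertPow δ (m + 1) G q
      = splitSum (fun C l s =>
          insertPow δ m (fun t => G (l.comp (.cons (pointAt δ C) t))) s) q := by
  rw [insertPow, List.replicate_succ, insertSum_cons]
  refine splitSum_congr fun C l q' _ _ => ?_
  cases q' with
  | nil => simp [splitSum_nil, insertTerm, insertPow]
  | cons f q' =>
    rw [splitSum_cons, splitSum_eq_zero fun D r s _ => ?_, add_zero]
    · simp [insertTerm, insertPow]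
    · simp [insertTerm, hδ _ _ (.cons f r) (by simp [HPath.length]), hG.comp_cons_zero,
        insertSum_zero]

theorem insertPow_succ_nil (hδ : HasArity 0 δ) {G : HPath H A A → X} (hG : IsMultilin k G)
    (m : ℕ) :
    insertPow δ (m + 1) G (.nil A)
      = insertPow δ m (fun r => G (.cons (pointAt δ A) r)) (.nil A) := by
  rw [insertPow_succ hδ hG, splitSum_nil]; rfl

theorem insertPow_succ_cons (hδ : HasArity 0 δ) {G : HPath H A C → X} (hG : IsMultilin k G)
    (m : ℕ) (f : H B C d) (q : HPath H A B) :
    insertPow δ (m + 1) G (.cons f q)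
      = insertPow δ m (fun r => G (.cons (pointAt δ C) r)) (.cons f q)
        + insertPow δ (m + 1) (fun r => G (.cons f r)) q := by
  rw [insertPow_succ hδ hG, splitSum_cons, insertPow_succ hδ (hG.cons f)]; rfl

theorem insertPow_congr (hδ : HasArity 0 δ) {m : ℕ} {G' : HPath H A B → X} (hG : IsMultilin k G)
    (hG' : IsMultilin k G') {q : HPath H A B}
    (h : ∀ r : HPath H A B, r.length = q.length + m → G r = G' r) :
    insertPow δ m G q = insertPow δ m G' q := by
  induction m generalizing A B with
  | zero => simpa only [insertPow_zero] using h q rfl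
  | succ m ih =>
    rw [insertPow_succ hδ hG, insertPow_succ hδ hG']
    exact splitSum_congr fun C l s _ hl =>
      ih ((hG.comp_left l).cons _) ((hG'.comp_left l).cons _) fun t ht =>
        h _ (by rw [HPath.length_comp, HPath.length]; omega)

theorem insertPow_eq_zero (hδ : HasArity 0 δ) {m : ℕ} (hG : IsMultilin k G)
    (h : VanishesFrom n G) {q : HPath H A B} (hm : n ≤ q.length + m) :
    insertPow δ m G q = 0 :=
  (insertPow_congr hδ hG IsMultilin.zero fun r hr => h r (by omega)).trans (insertSum_zero _ _)

theorem insertExp_nil (hδ : HasArity 0 δ) {G : HPath H A A → X} (hG : IsMultilin k G)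
    (h : VanishesFrom L G) :
    insertExp δ L G (.nil A)
      = G (.nil A) + insertExp δ L (fun r => G (.cons (pointAt δ A) r)) (.nil A) := by
  cases L with
  | zero => rw [h _ (by omega)]; simp [insertExp]
  | succ L =>
    simp only [insertExp]
    rw [Finset.sum_range_succ', Finset.sum_range_succ _ L,
      insertPow_eq_zero hδ (hG.cons (pointAt δ A)) (h.cons _) (by omega)]
    simp only [insertPow_succ_nil hδ hG, insertPow_zero, add_zero]
    abel

theorem insertExp_cons (hδ : HasArity 0 δ) {G : HPath H A C → X} (hG : IsMultilin k G)
    (h : VanishesFrom L G) (f : H B C d) (q : HPath H A B) :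
    insertExp δ L G (.cons f q)
      = insertExp δ L (fun r => G (.cons f r)) q
        + insertExp δ L (fun r => G (.cons (pointAt δ C) r)) (.cons f q) := by
  cases L with
  | zero => simp [insertExp]
  | succ L =>
    simp only [insertExp]
    rw [Finset.sum_range_succ', Finset.sum_range_succ' _ L, Finset.sum_range_succ _ L,
      insertPow_eq_zero hδ (hG.cons (pointAt δ C)) (h.cons _)
        (by simp only [HPath.length]; omega)]
    simp only [insertPow_succ_cons hδ hG, Finset.sum_add_distrib, insertPow_zero, add_zero]
    abel

theorem IsMultilin.insertExp {A' B' : Ob} {F : HPath H A B → HPath H A' B' → X}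
    (hF : ∀ r, IsMultilin k fun x => F x r) (q : HPath H A' B') :
    IsMultilin k fun x => insertExp δ L (F x) q :=
  finset_sum _ fun _ _ => .insertSum hF _ q

theorem insertExp_splitSum (hδ : HasArity 0 δ) (hn : n ≤ L)
    {F : ∀ C : Ob, HPath H C B → HPath H A C → X} (hF : IsBimultilin k F)
    (h : ∀ C r s, n ≤ r.length + s.length → F C r s = 0) (q : HPath H A B) :
    insertExp δ L (splitSum F) q = splitSum (fun C r s =>
      insertExp δ L (fun r' => insertExp δ L (F C r') s) r) q := by
  induction n generalizing B with
  | zero =>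
    obtain rfl : F = fun _ _ _ => 0 := funext fun C => funext fun r => funext fun s =>
      h C r s (Nat.zero_le _)
    simp only [funext splitSum_zero, insertExp_zero_fun, splitSum_zero]
  | succ n ihn =>
    have hS {B} {F : ∀ C : Ob, HPath H C B → HPath H A C → X}
        (h : ∀ C r s, n + 1 ≤ r.length + s.length → F C r s = 0) : VanishesFrom L (splitSum F) :=
      fun q hq => splitSum_eq_zero fun C r s hr => h C r s (by omega)
    have hδF {B} {F : ∀ C : Ob, HPath H C B → HPath H A C → X} (hF : IsBimultilin k F)
        (h : ∀ C r s, n + 1 ≤ r.length + s.length → F C r s = 0) :=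
      ihn (by omega) (hF.cons (pointAt δ B)) fun C r s hr => h C _ s (by
        simp only [HPath.length]; omega)
    have hE {B} {F : ∀ C : Ob, HPath H C B → HPath H A C → X} (hF : IsBimultilin k F) {C}
        (s : HPath H A C) : IsMultilin k fun r => insertExp δ L (F C r) s :=
      .insertExp (hF.left C) s
    have hV {B} {F : ∀ C : Ob, HPath H C B → HPath H A C → X}
        (h : ∀ C r s, n + 1 ≤ r.length + s.length → F C r s = 0) {C} (s : HPath H A C) :
        VanishesFrom L fun r => insertExp δ L (F C r) s :=
      vanishesFrom_insertExp_left (fun r s hr => h C r s (by omega)) hn s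
    induction q with
    | nil =>
      simp only [insertExp_nil hδ hF.isMultilin_splitSum (hS h), splitSum_cons, splitSum_nil,
        insertExp_add, hδF hF h, insertExp_nil hδ (hE hF _) (hV h _)]
      rw [insertExp_nil hδ (hF.right _ _) fun s hs => h _ _ s (by omega)]
      abel
    | @cons B C d f q ihq =>
      have hf := ihq (hF.cons f) fun C r s hr => h C _ s (by simp only [HPath.length]; omega)
      rw [insertExp_cons hδ hF.isMultilin_splitSum (hS h)]
      simp only [splitSum_cons, insertExp_add, hδF hF h, hf, insertExp_nil hδ (hE hF _) (hV h _),
        insertExp_cons hδ (hE hF _) (hV h _), splitSum_add]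
      rw [insertExp_cons hδ (hF.right _ _) fun s hs => h _ _ s (by omega)]
      abel

theorem insertExp_comp_cons (hδ : HasArity 0 δ) (hn : n ≤ L) {D : Ob} (hG : IsMultilin k G)
    (h : VanishesFrom n G) (l : HPath H D B) (x : H C D d) (t : HPath H A C) :
    insertExp δ L G (l.comp (.cons x t))
      = insertExp δ L (fun l' => insertExp δ L (fun t' => G (l'.comp (.cons x t'))) t) l := by
  induction n generalizing B with
  | zero =>
    obtain rfl : G = fun _ => 0 := funext fun r => h r (Nat.zero_le _)
    simp only [insertExp_zero_fun]
  | succ n ihn =>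
    have hδG {B} {G : HPath H A B → X} (hG : IsMultilin k G) (h : VanishesFrom (n + 1) G) :=
      ihn (by omega) (hG.cons (pointAt δ B)) (h.cons _)
    have hE {B} {G : HPath H A B → X} (hG : IsMultilin k G) : IsMultilin k fun l' : HPath H D B =>
        insertExp δ L (fun t' => G (l'.comp (.cons x t'))) t :=
      .insertExp (fun t' => hG.comp_right _) t
    have hV {B} {G : HPath H A B → X} (h : VanishesFrom (n + 1) G) :
        VanishesFrom L fun l' : HPath H D B =>
          insertExp δ L (fun t' => G (l'.comp (.cons x t'))) t :=
      vanishesFrom_insertExp_left (fun l' t' hl => h _ (by rw [HPath.length_comp]; omega)) hn t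
    induction l with
    | nil =>
      simp only [HPath.comp]
      rw [insertExp_cons hδ hG (h.mono hn), insertExp_nil hδ (hE hG) (hV h)]
      congr 1
      exact hδG hG h (.nil _)
    | cons f l ihl =>
      simp only [HPath.comp]
      rw [insertExp_cons hδ hG (h.mono hn), insertExp_cons hδ (hE hG) (hV h)]
      congr 1
      · exact ihl (hG.cons f) ((h.cons f).mono (by omega))
      · exact hδG hG h (.cons f l)

/-- The sum over `m < L` of the cochains `ψ{δ^{⊗ m}}`. -/
def expCochain (δ : RawCochain H) (L : ℕ) (ψ : RawCochain H) : RawCochain H :=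
  fun A B q e => insertExp δ L (fun r => ψ A B r e) q

theorem insertExp_insertSum_entry (ψs : List (ℤ × RawCochain H)) {D E A' B' : Ob} {e : ℤ}
    (hG : IsMultilin k G) (l : HPath H D B) (s : HPath H A E) (φ : HPath H A' B' → H E D e)
    (m : HPath H A' B') :
    insertExp δ L (insertSum ψs fun t => G (l.comp (.cons (insertExp δ L φ m) t))) s
      = insertExp δ L (fun m' =>
          insertExp δ L (insertSum ψs fun t => G (l.comp (.cons (φ m') t))) s) m :=
  map_insertExp φ m (AddMonoidHom.mk'
    (fun x => insertExp δ L (insertSum ψs fun t => G (l.comp (.cons x t))) s) fun x y => by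
      have hx (t : HPath H A E) := (hG.entryLin l t).map_add x y
      simp only [IsMultilin.entryLin, LinearMap.coe_mk, AddHom.coe_mk] at hx
      simp only [hx, funext (insertSum_add _ _ _), insertExp_add])

theorem insertExp_insertTerm (hδ : HasArity 0 δ) {N : ℕ} {ψ : ℤ × RawCochain H}
    {ψs : List (ℤ × RawCochain H)}
    (ih : ∀ {D n} {K : HPath H A D → X}, IsMultilin k K → VanishesFrom n K →
      n + N ≤ L → ∀ s, insertExp δ L (insertSum ψs K) s
        = insertSum (ψs.map fun ψ => (ψ.1, expCochain δ L ψ.2)) (insertExp δ L K) s)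
    (hG : IsMultilin k G) (h : VanishesFrom n G) (hn : n + N ≤ L)
    {C D : Ob} (l : HPath H C B) (m : HPath H D C) (s : HPath H A D) :
    insertExp δ L (fun l' => insertExp δ L (fun m' =>
        insertExp δ L (insertTerm ψ ψs G l' m') s) m) l
      = insertTerm (ψ.1, expCochain δ L ψ.2) (ψs.map fun ψ => (ψ.1, expCochain δ L ψ.2))
          (insertExp δ L G) l m s := by
  set Ψs := ψs.map fun ψ => (ψ.1, expCochain δ L ψ.2) with hΨs
  have hw : (Ψs.map Prod.fst).sum = (ψs.map Prod.fst).sum := by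
    simp [hΨs, Function.comp_def]
  set ε := ((ψ.1 + (ψs.map Prod.fst).sum) * l.sdeg + (ψs.map Prod.fst).sum * m.sdeg).negOnePow
  set x := expCochain δ L ψ.2 D C m (m.sdeg + ψ.1 + 1) with hx
  calc
    _ = insertExp δ L (fun l' => insertExp δ L (fun m' => insertExp δ L (fun s' => ε •
          insertSum ψs (fun t => G (l'.comp (.cons (ψ.2 D C m' (m.sdeg + ψ.1 + 1)) t))) s')
          s) m) l :=
      insertExp_congr fun l' hl => insertExp_congr fun m' hm => insertExp_congr fun s' _ => by
        rw [insertTerm, hl, hm]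
    _ = ε • insertExp δ L (fun l' =>
          insertExp δ L (insertSum ψs fun t => G (l'.comp (.cons x t))) s) l := by
      simp only [insertExp_smul, hx, expCochain, insertExp_insertSum_entry ψs hG]
    _ = ε • insertExp δ L (fun l' =>
          insertSum Ψs (insertExp δ L fun t => G (l'.comp (.cons x t))) s) l := by
      congr 2
      funext l'
      exact ih ((hG.comp_left l').cons x) (((h.comp_left l').cons x).mono (by omega)) hn s
    _ = ε • insertSum Ψs (fun t => insertExp δ L G (l.comp (.cons x t))) s := by
      simp only [insertExp_insertSum_comm,
        insertExp_comp_cons hδ (Nat.le_of_add_right_le hn) hG h l x]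
    _ = _ := by rw [insertTerm, hw]

/-- The copies of `δ` fall either into an argument of some `ψ_i` or beside all of them. -/
theorem insertExp_insertSum (hδ : HasArity 0 δ) {N : ℕ} {ψs : List (ℤ × RawCochain H)}
    (hψk : ∀ ψ ∈ ψs, ∀ A B e, IsMultilin k fun q => ψ.2 A B q e)
    (hψ : ∀ ψ ∈ ψs, ∀ A B e, VanishesFrom N fun q => ψ.2 A B q e)
    (hG : IsMultilin k G) (h : VanishesFrom n G) (hL : n + ψs.length * N ≤ L) (q : HPath H A B) :
    insertExp δ L (insertSum ψs G) q
      = insertSum (ψs.map fun ψ => (ψ.1, expCochain δ L ψ.2)) (insertExp δ L G) q := by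
  induction ψs generalizing n A B with
  | nil => simp only [List.map_nil, insertSum_nil, funext (insertSum_nil G)]
  | cons ψ ψs ih =>
    rw [List.forall_mem_cons] at hψk hψ
    rw [List.length_cons, add_mul, one_mul, ← add_assoc] at hL
    have hzero {C D} (l : HPath H C B) (m : HPath H D C) (s : HPath H A D) :=
      insertTerm_eq_zero hψ.1 (fun hK hn => hn.insertSum hψ.2 hK) hG h l m s
    have hmul {D} {K : HPath H A D → X} (hK : IsMultilin k K) : IsMultilin k (insertSum ψs K) :=
      isMultilin_insertSum hψk.2 hK
    rw [funext (insertSum_cons ψ ψs G), List.map_cons, insertSum_cons,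
      insertExp_splitSum (n := n + (ψs.length * N + N)) hδ (by omega)
        (isBimultilin_splitSum_insertTerm hψk.1 hmul hG)
        fun C l q' hl => splitSum_eq_zero fun D m s hm => hzero l m s (by omega)]
    refine splitSum_congr fun C l q' _ _ => ?_
    have hcut (l' : HPath H C B) := insertExp_splitSum (F := fun _ m s => insertTerm ψ ψs G l' m s)
      (L := L) (n := n + (ψs.length * N + N)) hδ (by omega)
      (isBimultilin_insertTerm hψk.1 hmul hG l') (fun D m s hm => hzero l' m s (by omega)) q'
    simp only [hcut, insertExp_splitSum_comm]
    exact splitSum_congr fun D m s _ _ =>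
      insertExp_insertTerm hδ (fun hK hn hL s => ih hψk.2 hψ.2 hK hn hL s) hG h (by omega) l m s

end Exponential

/-! ### Sums over matrix entries -/

section Entries

variable {Ob : Type u} {H : Ob → Ob → ℤ → Type v} [∀ A B d, AddCommGroup (H A B d)]
  {k : Type*} [CommRing k] [∀ A B d, Module k (H A B d)]
  {T : Set (TwObj.{u, v, w} H)} {X Y : Type*} [AddCommGroup X] [AddCommGroup Y]

open Classical in
/-- The effect on functions of strings of matrix entries of appending the matrix `f` on the left:
the recursion step of `entrySum`. -/
noncomputable def entryStep {L N : T} {A : Ob} {d : ℤ} (a : ℤ) (f : TwHom T L N d)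
    (G : ∀ j : N.1.I, HPath H A (N.1.obj j) → X) (l : L.1.I) (r : HPath H A (L.1.obj l)) : X :=
  (f l).sum fun j x =>
    (((d + N.1.shift j - L.1.shift l) - 1) * (L.1.shift l - a)).negOnePow • G j (.cons x r)

theorem entrySum_nil {M : T} (i : M.1.I)
    (G : ∀ j : M.1.I, HPath H (M.1.obj i) (M.1.obj j) → X) :
    entrySum T i (.nil M) G = G i (.nil _) := rfl

theorem entrySum_cons {M L N : T} {d : ℤ} (i : M.1.I) (f : TwHom T L N d)
    (q : HPath (TwHom T) M L) (G : ∀ j : N.1.I, HPath H (M.1.obj i) (N.1.obj j) → X) :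
    entrySum T i (.cons f q) G = entrySum T i q (entryStep (M.1.shift i) f G) := rfl

variable {M L N : T} {A : Ob} {a d : ℤ} {i : M.1.I}

section EntryStep

variable (f : TwHom T L N d) (G G' : ∀ j : N.1.I, HPath H A (N.1.obj j) → X) (l : L.1.I)
  (r : HPath H A (L.1.obj l))

theorem entryStep_add :
    entryStep a f (fun j r => G j r + G' j r) l r
      = entryStep a f G l r + entryStep a f G' l r := by
  simp [entryStep, DFinsupp.sum_add]

theorem map_entryStep (g : X →+ Y) :
    g (entryStep a f G l r) = entryStep a f (fun j r => g (G j r)) l r := by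
  simp [entryStep, DFinsupp.sum, map_sum, Units.smul_def]

end EntryStep

section EntrySum

variable (q : HPath (TwHom T) M N) (G G' : ∀ j : N.1.I, HPath H (M.1.obj i) (N.1.obj j) → X)

theorem entrySum_add :
    entrySum T i q (fun j r => G j r + G' j r) = entrySum T i q G + entrySum T i q G' := by
  induction q with
  | nil => rfl
  | cons f q ih => simp only [entrySum_cons, ← ih, ← entryStep_add]

theorem map_entrySum (g : X →+ Y) :
    g (entrySum T i q G) = entrySum T i q (fun j r => g (G j r)) := by
  induction q with
  | nil => rfl
  | cons f q ih => simp only [entrySum_cons, ih, map_entryStep]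

theorem entrySum_smul {R : Type*} [DistribSMul R X] (c : R) :
    entrySum T i q (fun j r => c • G j r) = c • entrySum T i q G :=
  (map_entrySum q G (DistribSMul.toAddMonoidHom X c)).symm

theorem entrySum_zero : entrySum T i q (fun _ _ => (0 : X)) = 0 := by
  simpa using (map_entrySum q (fun _ _ => (0 : X)) (0 : X →+ X)).symm

theorem entrySum_list_sum {ι : Type*} (S : List ι)
    (F : ∀ j : N.1.I, HPath H (M.1.obj i) (N.1.obj j) → ι → X) :
    entrySum T i q (fun j r => (S.map (F j r)).sum)
      = (S.map fun a => entrySum T i q fun j r => F j r a).sum := by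
  induction S with
  | nil => exact entrySum_zero q
  | cons a S ih => simp only [List.map_cons, List.sum_cons, entrySum_add, ih]

theorem entrySum_splitSum_comm {B C : Ob}
    (F : ∀ j : N.1.I, HPath H (M.1.obj i) (N.1.obj j) → ∀ D, HPath H D C → HPath H B D → X)
    (s : HPath H B C) :
    entrySum T i q (fun j r => splitSum (F j r) s)
      = splitSum (fun D m t => entrySum T i q fun j r => F j r D m t) s :=
  entrySum_list_sum q _ _

theorem entrySum_insertSum_comm (ψs : List (ℤ × RawCochain H)) {B C : Ob}
    (F : ∀ j : N.1.I, HPath H (M.1.obj i) (N.1.obj j) → HPath H B C → X) (s : HPath H B C) :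
    entrySum T i q (fun j r => insertSum ψs (F j r) s)
      = insertSum ψs (fun t => entrySum T i q fun j r => F j r t) s := by
  simp only [insertSum, entrySum_list_sum, entrySum_smul]

variable {q G G'}

theorem entrySum_congr
    (h : ∀ j r, r.sdeg = q.sdeg + N.1.shift j - M.1.shift i → r.length = q.length →
      G j r = G' j r) : entrySum T i q G = entrySum T i q G' := by
  induction q with
  | nil => exact h _ _ (by simp [HPath.sdeg]) rfl
  | cons f q ih =>
    refine ih fun l r h1 h2 => Finset.sum_congr rfl fun j _ => ?_
    beta_reduce
    rw [h]
    · simp only [HPath.sdeg, h1]; ring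
    · simp [HPath.length, h2]

end EntrySum

/-- Moving the shift of the column index of `l` past the entries of `l` produces the sign. -/
theorem entrySum_comp (l : HPath (TwHom T) L N) (t : HPath (TwHom T) M L)
    (G : ∀ j : N.1.I, HPath H (M.1.obj i) (N.1.obj j) → X) :
    entrySum T i (l.comp t) G = entrySum T i t fun c t' => entrySum T c l fun j l' =>
      (l'.sdeg * (L.1.shift c - M.1.shift i)).negOnePow • G j (l'.comp t') := by
  induction l with
  | nil => simp [entrySum_nil, HPath.comp, HPath.sdeg]
  | cons f l ih =>
    rw [HPath.comp, entrySum_cons, ih]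
    refine entrySum_congr fun c t' _ _ => ?_
    rw [entrySum_cons]
    refine entrySum_congr fun b l' _ _ => ?_
    simp only [entryStep, DFinsupp.sum, Finset.smul_sum, smul_smul, ← Int.negOnePow_add,
      HPath.sdeg, HPath.comp]
    refine Finset.sum_congr rfl fun j _ => ?_
    congr 2
    ring

theorem entryStep_splitSum (f : TwHom T L N d)
    (F : ∀ (j : N.1.I) (C : Ob), HPath H C (N.1.obj j) → HPath H A C → X) (l : L.1.I)
    (r : HPath H A (L.1.obj l)) :
    entryStep a f (fun j => splitSum (F j)) l r
      = entryStep a f (fun j => F j _ (.nil _)) l r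
        + splitSum (fun C r' s => entryStep a f (fun j r => F j C r s) l r') r := by
  have hcons (j : N.1.I) (x : H (L.1.obj l) (N.1.obj j) (d + N.1.shift j - L.1.shift l)) :=
    splitSum_cons r (F j) x
  simp only [entryStep, DFinsupp.sum, hcons, smul_add, Finset.sum_add_distrib, ← splitSum_smul,
    splitSum_sum]

theorem entrySum_splitSum (q : HPath (TwHom T) M N)
    (F : ∀ (j : N.1.I) (C : Ob), HPath H C (N.1.obj j) → HPath H (M.1.obj i) C → X) :
    entrySum T i q (fun j => splitSum (F j)) = splitSum (fun L r s =>
      entrySum T i s fun l s' => entrySum T l r fun j r' =>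
        (r'.sdeg * (L.1.shift l - M.1.shift i)).negOnePow • F j (L.1.obj l) r' s') q := by
  induction q with
  | nil => simp [entrySum_nil, splitSum_nil, HPath.sdeg]
  | @cons L N d f q ih =>
    have hstep := funext fun l => funext (entryStep_splitSum (a := M.1.shift i) f F l)
    rw [entrySum_cons, hstep, entrySum_add,
      ih fun l C r' s' => entryStep (M.1.shift i) f (fun j r => F j C r s') l r', splitSum_cons]
    congr 1
    · simp only [entrySum_nil, HPath.sdeg, zero_mul, Int.negOnePow_zero, one_smul]
      rfl
    · refine splitSum_congr fun L' r s _ _ => entrySum_congr fun l' s' _ _ => ?_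
      rw [entrySum_cons]
      refine entrySum_congr fun l r' _ _ => ?_
      simp only [entryStep, DFinsupp.sum, Finset.smul_sum, smul_smul, ← Int.negOnePow_add,
        HPath.sdeg]
      refine Finset.sum_congr rfl fun j _ => ?_
      congr 2
      ring

section Linear

variable [Module k X] [Module k Y]

theorem entryStep_eq_lsum [DecidableEq N.1.I] (f : TwHom T L N d)
    {G : ∀ j : N.1.I, HPath H A (N.1.obj j) → X} (hG : ∀ j, IsMultilin k (G j)) (l : L.1.I)
    (r : HPath H A (L.1.obj l)) :
    entryStep a f G l r = DFinsupp.lsum ℕ (fun j =>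
      (((d + N.1.shift j - L.1.shift l) - 1) * (L.1.shift l - a)).negOnePow •
        (hG j).entryLin (.nil _) r) (f l) := by
  classical
  rw [DFinsupp.lsum_apply_apply, DFinsupp.sumAddHom_apply, entryStep]
  congr!

theorem entryStep_add_smul (f g : TwHom T L N d) (c : k)
    {G : ∀ j : N.1.I, HPath H A (N.1.obj j) → X} (hG : ∀ j, IsMultilin k (G j)) (l : L.1.I)
    (r : HPath H A (L.1.obj l)) :
    entryStep a (f + c • g) G l r = entryStep a f G l r + c • entryStep a g G l r := by
  classical
  simp only [entryStep_eq_lsum _ hG]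
  rw [Pi.add_apply, map_add, Pi.smul_apply, map_smul]

theorem isMultilin_entryStep (f : TwHom T L N d)
    {G : ∀ j : N.1.I, HPath H A (N.1.obj j) → X} (hG : ∀ j, IsMultilin k (G j)) (l : L.1.I) :
    IsMultilin k (entryStep a f G l) :=
  .finset_sum _ fun j _ => ((hG j).cons _).smul _

theorem isMultilin_entrySum {G : ∀ j : N.1.I, HPath H (M.1.obj i) (N.1.obj j) → X}
    (hG : ∀ j, IsMultilin k (G j)) :
    IsMultilin k fun q : HPath (TwHom T) M N => entrySum T i q G := by
  intro c q q' q'' h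
  induction h with
  | head f g q =>
    simp only [entrySum_cons]
    rw [← entrySum_smul, ← entrySum_add]
    congr 1
    exact funext fun l => funext fun r => entryStep_add_smul f g c hG l r
  | tail f _ ih => exact ih (isMultilin_entryStep f hG)

theorem IsMultilin.entrySum {A' B' : Ob} (q : HPath (TwHom T) M N)
    {F : HPath H A' B' → ∀ j : N.1.I, HPath H (M.1.obj i) (N.1.obj j) → X}
    (hF : ∀ j r, IsMultilin k fun x => F x j r) : IsMultilin k fun x => entrySum T i q (F x) := by
  induction q with
  | nil => exact hF _ _
  | cons f _ ih => exact ih fun l r => .finset_sum _ fun j _ => (hF _ _).smul _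

theorem entryStep_eq_sum (f : TwHom T L N d)
    {G : ∀ j : N.1.I, HPath H A (N.1.obj j) → X} (hG : ∀ j, IsMultilin k (G j)) (l : L.1.I)
    (r : HPath H A (L.1.obj l)) {J : Finset N.1.I} (hJ : ∀ j ∉ J, f l j = 0) :
    entryStep a f G l r = ∑ j ∈ J,
      (((d + N.1.shift j - L.1.shift l) - 1) * (L.1.shift l - a)).negOnePow •
        G j (.cons (f l j) r) := by
  classical
  refine Finset.sum_subset (fun j hj => ?_) fun j _ hj => ?_
  · by_contra h
    exact (DFinsupp.mem_support_iff.1 hj) (hJ j h)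
  · have : f l j = 0 := by simpa using hj
    simp only [this, (hG j).cons_zero, smul_zero]

theorem entryStep_extend {L' : T} (p : ℤ) (ψ : RawCochain H) (r : HPath (TwHom T) L' N) (e a : ℤ)
    {G : ∀ j : N.1.I, HPath H A (N.1.obj j) → X} (hG : ∀ j, IsMultilin k (G j)) (l : L'.1.I)
    (t : HPath H A (L'.1.obj l)) :
    entryStep a (extend T p ψ L' N r e) G l t = entrySum T l r fun j r' =>
      ((p * (N.1.shift j - L'.1.shift l)).negOnePow *
        ((e + N.1.shift j - L'.1.shift l - 1) * (L'.1.shift l - a)).negOnePow) •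
        G j (.cons (ψ _ _ r' (e + N.1.shift j - L'.1.shift l)) t) := by
  classical
  rw [entryStep_eq_lsum _ hG]
  refine (map_entrySum r _ (AddMonoidHomClass.toAddMonoidHom _)).trans
    (entrySum_congr fun j r' _ _ => ?_)
  simp only [Units.smul_def, map_zsmul, mul_smul]
  congr 1
  exact DFinsupp.sumAddHom_single _ _ _

theorem insertTerm_extend {K : T} {ψ : ℤ × RawCochain H} {ψs : List (ℤ × RawCochain H)}
    (ih : ∀ {N : T} {G : ∀ j : N.1.I, HPath H (M.1.obj i) (N.1.obj j) → X},
      (∀ j, IsMultilin k (G j)) → ∀ q : HPath (TwHom T) M N,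
      insertSum (ψs.map fun ψ => (ψ.1, extend T ψ.1 ψ.2)) (fun r => entrySum T i r G) q
        = entrySum T i q fun j r =>
          ((ψs.map Prod.fst).sum * (N.1.shift j - M.1.shift i)).negOnePow • insertSum ψs (G j) r)
    {G : ∀ j : N.1.I, HPath H (M.1.obj i) (N.1.obj j) → X} (hG : ∀ j, IsMultilin k (G j))
    (l : HPath (TwHom T) L N) (m : HPath (TwHom T) K L) (s : HPath (TwHom T) M K) :
    insertTerm (ψ.1, extend T ψ.1 ψ.2) (ψs.map fun ψ => (ψ.1, extend T ψ.1 ψ.2))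
        (fun r => entrySum T i r G) l m s
      = entrySum T i s fun b s' => entrySum T b m fun c m' =>
        (m'.sdeg * (K.1.shift b - M.1.shift i)).negOnePow • entrySum T c l fun j l' =>
        (l'.sdeg * (L.1.shift c - M.1.shift i)).negOnePow •
        ((ψ.1 + (ψs.map Prod.fst).sum) * (N.1.shift j - M.1.shift i)).negOnePow •
          insertTerm ψ ψs (G j) l' m' s' := by
  set w := (ψs.map Prod.fst).sum with hw
  have hw' : ((ψs.map fun ψ => (ψ.1, extend T ψ.1 ψ.2)).map Prod.fst).sum = w := by
    simp [hw, Function.comp_def]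
  have hmul (c : L.1.I) : IsMultilin k fun t' => entrySum T c l fun j l' =>
      (l'.sdeg * (L.1.shift c - M.1.shift i)).negOnePow • G j (l'.comp t') :=
    .entrySum l fun j l' => ((hG j).comp_left l').smul _
  simp only [insertTerm, hw', entrySum_comp, entrySum_cons]
  rw [ih (fun b => isMultilin_entryStep _ hmul b) s, ← entrySum_smul]
  refine entrySum_congr fun b s' _ _ => ?_
  simp only [funext (entryStep_extend ψ.1 ψ.2 m (m.sdeg + ψ.1 + 1) _ hmul b),
    ← entrySum_insertSum_comm, ← entrySum_smul, ← insertSum_smul]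
  refine entrySum_congr fun c m' hm _ => entrySum_congr fun j l' hl _ => ?_
  rw [show m.sdeg + ψ.1 + 1 + L.1.shift c - K.1.shift b = m'.sdeg + ψ.1 + 1 by omega]
  simp only [insertSum_smul, smul_smul, ← Int.negOnePow_add]
  congr 1
  rw [Int.negOnePow_eq_iff, hm, hl, ← hw]
  exact ⟨ψ.1 * (L.1.shift c - N.1.shift j) + w * (K.1.shift b - N.1.shift j), by ring⟩

theorem insertSum_extend {ψs : List (ℤ × RawCochain H)}
    {G : ∀ j : N.1.I, HPath H (M.1.obj i) (N.1.obj j) → X} (hG : ∀ j, IsMultilin k (G j))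
    (q : HPath (TwHom T) M N) :
    insertSum (ψs.map fun ψ => (ψ.1, extend T ψ.1 ψ.2)) (fun r => entrySum T i r G) q
      = entrySum T i q fun j r =>
        ((ψs.map Prod.fst).sum * (N.1.shift j - M.1.shift i)).negOnePow •
          insertSum ψs (G j) r := by
  induction ψs generalizing N with
  | nil => simp
  | cons ψ ψs ih =>
    simp only [List.map_cons, List.sum_cons, insertSum_cons, insertTerm_extend ih hG,
      ← splitSum_smul, entrySum_splitSum]
    refine splitSum_congr fun L l q' _ _ => ?_
    simp only [entrySum_splitSum_comm, entrySum_splitSum, ← entrySum_smul]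

end Linear

open Classical in
/-- The contribution of a string of entries to the matrix `extend T p φ (f_n, …, f_1)`. -/
noncomputable def extendTerm (p : ℤ) (φ : RawCochain H) (i : M.1.I) (e : ℤ) (j : N.1.I)
    (r : HPath H (M.1.obj i) (N.1.obj j)) :
    Π₀ j : N.1.I, H (M.1.obj i) (N.1.obj j) (e + N.1.shift j - M.1.shift i) :=
  (p * (N.1.shift j - M.1.shift i)).negOnePow •
    DFinsupp.single j (φ _ _ r (e + N.1.shift j - M.1.shift i))

theorem extend_apply (p : ℤ) (φ : RawCochain H) (q : HPath (TwHom T) M N) (e : ℤ) (i : M.1.I) :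
    extend T p φ M N q e i = entrySum T i q (extendTerm p φ i e) := rfl

section Extend

variable {p : ℤ} {φ : RawCochain H}

theorem isMultilin_extendTerm (hφ : IsCochain k p φ) (i : M.1.I) (e : ℤ) (j : N.1.I) :
    IsMultilin k (extendTerm p φ i e j) := by
  classical
  exact ((hφ.isMultilin _ _ (e + N.1.shift j - M.1.shift i)).map
    (DFinsupp.lsingle (R := k)
      (M := fun j : N.1.I => H (M.1.obj i) (N.1.obj j) (e + N.1.shift j - M.1.shift i)) j)).smul _

theorem IsCochain.extend (hφ : IsCochain k p φ) : IsCochain k p (extend T p φ) := by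
  classical
  refine isCochain_iff.2 ⟨fun M N q e he => funext fun i => ?_, fun M N e c q q' q'' h =>
    funext fun i => isMultilin_entrySum (isMultilin_extendTerm hφ i e) c q q' q'' h⟩
  rw [extend_apply, Pi.zero_apply, ← entrySum_zero (i := i) q]
  refine entrySum_congr fun j r hr _ => ?_
  rw [extendTerm, hφ.eq_zero _ _ _ _ (by omega), DFinsupp.single_zero, smul_zero]

theorem brace_apply_col (Φ : RawCochain (TwHom T)) (Ψs : List (ℤ × RawCochain (TwHom T)))
    (q : HPath (TwHom T) M N) (e : ℤ) (i : M.1.I) :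
    brace Φ Ψs M N q e i = insertSum Ψs (fun r => Φ M N r e i) q :=
  map_insertSum Ψs (fun r => Φ M N r e) q (Pi.evalAddMonoidHom (fun i : M.1.I =>
    Π₀ j : N.1.I, H (M.1.obj i) (N.1.obj j) (e + N.1.shift j - M.1.shift i)) i)

theorem extend_brace (hφ : IsCochain k p φ) (ψs : List (ℤ × RawCochain H)) :
    extend T (p + (ψs.map Prod.fst).sum) (brace φ ψs)
      = brace (extend T p φ) (ψs.map fun ψ => (ψ.1, extend T ψ.1 ψ.2)) := by
  classical
  funext M N q e i
  simp only [brace_apply_col, extend_apply]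
  rw [insertSum_extend (isMultilin_extendTerm hφ i e)]
  refine entrySum_congr fun j r _ _ => ?_
  rw [extendTerm, brace_eq_insertSum, funext fun r => extendTerm.eq_1 p φ i e j r,
    insertSum_smul, smul_smul, ← Int.negOnePow_add, ← add_mul, add_comm p]
  congr 1
  exact map_insertSum ψs _ r (DFinsupp.singleAddHom (fun j : N.1.I =>
    H (M.1.obj i) (N.1.obj j) (e + N.1.shift j - M.1.shift i)) j)

theorem hasArity_deltaCochain : HasArity 0 (deltaCochain T) := fun M N q hq => by
  cases q with
  | nil => exact absurd rfl hq
  | cons f q => rfl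

theorem isCochain_deltaCochain (T : Set (TwObj.{u, v, w} H)) :
    IsCochain k 0 (deltaCochain T) := by
  refine isCochain_iff.2 ⟨fun M N q e he => ?_, fun M N e c q q' q'' h => ?_⟩
  · cases q with
    | nil => exact Pi.single_eq_of_ne (by simpa [HPath.sdeg] using he) _
    | cons f q => rfl
  · cases h <;> simp [deltaCochain]

end Extend

end Entries

/-! ### Convergence of strings -/

section Convergence

variable {Ob : Type u} {H : Ob → Ob → ℤ → Type v} {ι : Type*}

/-- Convergence of a family of strings of constant shape, given a notion of convergence of
families of morphisms. -/
inductive PathTendsto (c : ∀ A B d, (ι → H A B d) → H A B d → Prop) :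
    ∀ {A B : Ob}, (ι → HPath H A B) → HPath H A B → Prop
  | nil (A : Ob) : PathTendsto c (fun _ => .nil A) (.nil A)
  | cons {A B C : Ob} {d : ℤ} {fs : ι → H B C d} {f : H B C d} {qs : ι → HPath H A B}
      {q : HPath H A B} (hf : c B C d fs f) (hq : PathTendsto c qs q) :
      PathTendsto c (fun n => .cons (fs n) (qs n)) (.cons f q)

namespace PathTendsto

variable {c c' : ∀ A B d, (ι → H A B d) → H A B d → Prop} {A B C : Ob}
  {qs : ι → HPath H A B} {q : HPath H A B}

theorem mono (hq : PathTendsto c qs q) (h : ∀ A B d fs f, c A B d fs f → c' A B d fs f) :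
    PathTendsto c' qs q := by
  induction hq with
  | nil => exact .nil _
  | cons hf _ ih => exact .cons (h _ _ _ _ _ hf) ih

theorem comp {rs : ι → HPath H B C} {r : HPath H B C} (hr : PathTendsto c rs r)
    (hq : PathTendsto c qs q) : PathTendsto c (fun n => (rs n).comp (qs n)) (r.comp q) := by
  induction hr with
  | nil => exact hq
  | cons hf _ ih => exact .cons hf ih

theorem sdeg_eq (hq : PathTendsto c qs q) (n : ι) : (qs n).sdeg = q.sdeg := by
  induction hq with
  | nil => rfl
  | cons _ _ ih => simp only [HPath.sdeg, ih]

theorem const (q : HPath H A B) :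
    PathTendsto (fun _ _ _ fs f => fs = fun _ : ι => f) (fun _ => q) q := by
  induction q with
  | nil => exact .nil _
  | cons f q ih => exact .cons rfl ih

theorem eq_const (hq : PathTendsto (fun _ _ _ fs f => fs = fun _ => f) qs q) :
    qs = fun _ => q := by
  induction hq with
  | nil => rfl
  | cons hf _ ih => rw [hf, ih]

end PathTendsto

variable {c c' : ∀ A B d, (ι → H A B d) → H A B d → Prop} {A B : Ob}
  {X : Type*} [AddCommGroup X] [TopologicalSpace X] [IsTopologicalAddGroup X] {l : Filter ι}
  {qs : ι → HPath H A B} {q : HPath H A B}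

theorem tendsto_splitSum {Fs : ι → ∀ C : Ob, HPath H C B → HPath H A C → X}
    {F : ∀ C : Ob, HPath H C B → HPath H A C → X}
    (hF : ∀ C rs r ss s, PathTendsto c rs r → PathTendsto c ss s →
      Tendsto (fun n => Fs n C (rs n) (ss n)) l (𝓝 (F C r s)))
    (hq : PathTendsto c qs q) :
    Tendsto (fun n => splitSum (Fs n) (qs n)) l (𝓝 (splitSum F q)) := by
  induction hq with
  | nil =>
    simp only [splitSum_nil]
    exact hF _ _ _ _ _ (.nil _) (.nil _)
  | cons hf hq ih =>
    simp only [splitSum_cons]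
    exact (hF _ _ _ _ _ (.nil _) (.cons hf hq)).add
      (ih fun C rs r ss s hr hs => hF _ _ _ _ _ (.cons hf hr) hs)

/-- The cochains in `ps` may turn `c`-convergence into a weaker convergence `c'`, as they do when
they themselves vary and the string is constant. -/
theorem tendsto_insertSum (hc : ∀ A B d fs f, c A B d fs f → c' A B d fs f) {α : Type*}
    {ps : List (ℤ × α)} {Ψs : ι → ℤ × α → RawCochain H} {Ψ : ℤ × α → RawCochain H}
    (hΨ : ∀ a ∈ ps, ∀ (A B : Ob) (qs : ι → HPath H A B) q, PathTendsto c qs q → ∀ e,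
      c' A B e (fun n => Ψs n a A B (qs n) e) (Ψ a A B q e))
    {Gs : ι → HPath H A B → X} {G : HPath H A B → X}
    (hG : ∀ rs r, PathTendsto c' rs r → Tendsto (fun n => Gs n (rs n)) l (𝓝 (G r)))
    (hq : PathTendsto c qs q) :
    Tendsto (fun n => insertSum (ps.map fun a => (a.1, Ψs n a)) (Gs n) (qs n)) l
      (𝓝 (insertSum (ps.map fun a => (a.1, Ψ a)) G q)) := by
  induction ps generalizing A B with
  | nil => simpa using hG _ _ (hq.mono hc)
  | cons a ps ih =>
    rw [List.forall_mem_cons] at hΨ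
    simp only [List.map_cons, insertSum_cons]
    refine tendsto_splitSum (fun C ls l q's q' hl hq' =>
      tendsto_splitSum (fun D ms m ss s hm hs => ?_) hq') hq
    simp only [insertTerm, List.map_map, Function.comp_def, hl.sdeg_eq]
    refine Tendsto.congr (fun n => ?_) ((ih hΨ.2
      (Gs := fun n t => Gs n ((ls n).comp (.cons (Ψs n a D C (ms n) (m.sdeg + a.1 + 1)) t)))
      (G := fun t => G (l.comp (.cons (Ψ a D C m (m.sdeg + a.1 + 1)) t)))
      (fun _ _ ht => hG _ _ ((hl.mono hc).comp (.cons (hΨ.1 _ _ _ _ hm _) ht))) hs).const_smul _)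
    rw [hm.sdeg_eq n]

theorem tendsto_insertSum_of_forall {ψs : List (ℤ × RawCochain H)} {Gs : ι → HPath H A B → X}
    {G : HPath H A B → X} (hG : ∀ r, Tendsto (fun n => Gs n r) l (𝓝 (G r))) (q : HPath H A B) :
    Tendsto (fun n => insertSum ψs (Gs n) q) l (𝓝 (insertSum ψs G q)) :=
  tendsto_list_sum _ fun x _ => (hG x.2).const_smul x.1

end Convergence

section Continuity

variable {Ob : Type u} {H : Ob → Ob → ℤ → Type v}

theorem HPath.ofFn_snoc (n : ℕ) (A : Fin (n + 2) → Ob) (d : Fin (n + 1) → ℤ)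
    (f : ∀ i : Fin n, H (A i.castSucc.castSucc) (A i.castSucc.succ) (d i.castSucc))
    (x : H (A (Fin.last n).castSucc) (A (Fin.last n).succ) (d (Fin.last n))) :
    ofFn (n + 1) A d (Fin.snoc (α := fun i => H (A i.castSucc) (A i.succ) (d i)) f x)
      = .cons x (ofFn n (fun i => A i.castSucc) (fun i => d i.castSucc) f) := by
  simp only [ofFn, Fin.snoc_last, Fin.snoc_castSucc]

variable [∀ A B d, TopologicalSpace (H A B d)] {ι : Type*} {l : Filter ι}

/-- Convergence of strings along a filter: all morphisms converge. -/
abbrev EntryTendsto (l : Filter ι) {A B : Ob} (qs : ι → HPath H A B) (q : HPath H A B) : Prop :=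
  PathTendsto (fun _ _ _ fs f => Tendsto fs l (𝓝 f)) qs q

theorem entryTendsto_ofFn (n : ℕ) (A : Fin (n + 1) → Ob) (d : Fin n → ℤ)
    {fs : ι → ∀ i : Fin n, H (A i.castSucc) (A i.succ) (d i)}
    {f : ∀ i : Fin n, H (A i.castSucc) (A i.succ) (d i)}
    (h : ∀ i, Tendsto (fun x => fs x i) l (𝓝 (f i))) :
    EntryTendsto l (fun x => HPath.ofFn n A d (fs x)) (HPath.ofFn n A d f) := by
  induction n with
  | zero => exact .nil _
  | succ n ih => exact .cons (h (Fin.last n)) (ih _ _ fun i => h i.castSucc)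

theorem EntryTendsto.ofFn_induction {A B : Ob} {qs : ι → HPath H A B} {q : HPath H A B}
    (h : EntryTendsto l qs q) (P : ∀ A B : Ob, (ι → HPath H A B) → HPath H A B → Prop)
    (hP : ∀ n (A : Fin (n + 1) → Ob) (d : Fin n → ℤ)
      (fs : ι → ∀ i : Fin n, H (A i.castSucc) (A i.succ) (d i))
      (f : ∀ i : Fin n, H (A i.castSucc) (A i.succ) (d i)), Tendsto fs l (𝓝 f) →
      P _ _ (fun x => HPath.ofFn n A d (fs x)) (HPath.ofFn n A d f)) :
    P A B qs q := by
  induction h generalizing P with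
  | nil =>
    exact hP 0 (fun _ => A) Fin.elim0 (fun _ i => i.elim0) (fun i => i.elim0)
      (tendsto_pi_nhds.2 fun i => i.elim0)
  | @cons _ C d xs x _ _ hx _ ih =>
    refine ih (fun A B qs q => ∀ (C : Ob) (d : ℤ) (xs : ι → H B C d) (x : H B C d),
      Tendsto xs l (𝓝 x) → P A C (fun n => .cons (xs n) (qs n)) (.cons x q)) ?_ C d xs x hx
    intro n A d fs f hf C e xs x hx
    obtain ⟨A', rfl, rfl⟩ : ∃ A' : Fin (n + 2) → Ob,
        (fun i : Fin (n + 1) => A' i.castSucc) = A ∧ A' (Fin.last _) = C :=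
      ⟨Fin.snoc A C, by simp, by simp⟩
    obtain ⟨d', rfl, rfl⟩ : ∃ d' : Fin (n + 1) → ℤ,
        (fun i : Fin n => d' i.castSucc) = d ∧ d' (Fin.last _) = e :=
      ⟨Fin.snoc d e, by simp, by simp⟩
    have hsnoc := hP (n + 1) A' d' _ _
      (hf.finSnoc (A := fun i => H (A' i.castSucc) (A' i.succ) (d' i)) hx)
    exact cast (by simp only [HPath.ofFn_snoc]; rfl) hsnoc

theorem IsContinuous.tendsto {φ : RawCochain H} (hφ : IsContinuous φ) {A B : Ob}
    {qs : ι → HPath H A B} {q : HPath H A B} (h : EntryTendsto l qs q) (e : ℤ) :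
    Tendsto (fun x => φ A B (qs x) e) l (𝓝 (φ A B q e)) :=
  h.ofFn_induction (fun A B qs q => Tendsto (fun x => φ A B (qs x) e) l (𝓝 (φ A B q e)))
    fun n A d _ f hf => ((hφ n A d e).tendsto f).comp hf

variable [∀ A B d, AddCommGroup (H A B d)] [∀ A B d, IsTopologicalAddGroup (H A B d)]

theorem IsContinuous.brace {φ : RawCochain H} (hφ : IsContinuous φ)
    {ψs : List (ℤ × RawCochain H)} (hψ : ∀ ψ ∈ ψs, IsContinuous ψ.2) :
    IsContinuous (brace φ ψs) := fun n A d e => continuous_iff_continuousAt.2 fun f => by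
  have h := tendsto_insertSum (l := 𝓝 f) (Ψs := fun _ ψ => ψ.2) (Ψ := Prod.snd)
    (Gs := fun _ r => φ _ _ r e) (fun _ _ _ _ _ h => h)
    (fun ψ hm _ _ _ _ hq => (hψ ψ hm).tendsto hq) (fun _ _ hr => hφ.tendsto hr e)
    (entryTendsto_ofFn n A d fun i => (continuous_apply i).tendsto f)
  simp only [Prod.mk.eta, List.map_id'] at h
  exact h

variable {k : Type*} [CommRing k] [∀ A B d, Module k (H A B d)]

theorem IsContCochain.brace {p : ℤ} {φ : RawCochain H} (hφ : IsContCochain k p φ)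
    {ψs : List (ℤ × RawCochain H)} (hψ : ∀ ψ ∈ ψs, IsContCochain k ψ.1 ψ.2) :
    IsContCochain k (p + (ψs.map Prod.fst).sum) (brace φ ψs) :=
  ⟨hφ.1.brace fun ψ h => (hψ ψ h).1, hφ.2.brace fun ψ h => (hψ ψ h).2⟩

end Continuity

/-! ### Continuity on matrices -/

section Columns

variable {Ob : Type u} {H : Ob → Ob → ℤ → Type v} [∀ A B d, AddCommGroup (H A B d)]
  {T : Set (TwObj.{u, v, w} H)}

theorem brace_apply_entry (Φ : RawCochain (TwHom T)) (Ψs : List (ℤ × RawCochain (TwHom T)))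
    {M N : T} (q : HPath (TwHom T) M N) (e : ℤ) (i : M.1.I) (j : N.1.I) :
    brace Φ Ψs M N q e i j = insertSum Ψs (fun r => Φ M N r e i j) q := by
  rw [brace_apply_col]
  exact map_insertSum Ψs (fun r => Φ M N r e i) q (DFinsupp.evalAddMonoidHom
    (β := fun j : N.1.I => H (M.1.obj i) (N.1.obj j) (e + N.1.shift j - M.1.shift i)) j)

theorem extend_apply_entry (p : ℤ) (φ : RawCochain H) {M N : T}
    (q : HPath (TwHom T) M N) (e : ℤ) (i : M.1.I) (j : N.1.I) :
    extend T p φ M N q e i j = entrySum T i q fun j' r => extendTerm p φ i e j' r j :=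
  map_entrySum q (extendTerm p φ i e) (DFinsupp.evalAddMonoidHom
    (β := fun j : N.1.I => H (M.1.obj i) (N.1.obj j) (e + N.1.shift j - M.1.shift i)) j)

variable [∀ A B d, TopologicalSpace (H A B d)] {ι : Type*} {l : Filter ι} {M N : T}

/-- Convergence of matrices along a filter: every column converges entrywise and has its support
in a fixed finite set. -/
def ColTendsto (l : Filter ι) (M N : T) (e : ℤ) (fs : ι → TwHom T M N e) (f : TwHom T M N e) :
    Prop :=
  ∀ i, (∃ J : Finset N.1.I, (∀ n, ∀ j ∉ J, fs n i j = 0) ∧ ∀ j ∉ J, f i j = 0) ∧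
    ∀ j, Tendsto (fun n => fs n i j) l (𝓝 (f i j))

theorem colTendsto_const {e : ℤ} (f : TwHom T M N e) : ColTendsto l M N e (fun _ => f) f := by
  classical
  exact fun i => ⟨⟨(f i).support, by simp⟩, fun j => tendsto_const_nhds⟩

theorem colTendsto_deltaCochain {qs : ι → HPath (TwHom T) M N} {q : HPath (TwHom T) M N}
    (hq : PathTendsto (ColTendsto l) qs q) (e : ℤ) :
    ColTendsto l M N e (fun n => deltaCochain T M N (qs n) e) (deltaCochain T M N q e) := by
  cases hq with
  | nil => exact colTendsto_const _
  | cons => exact colTendsto_const _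

variable {k : Type*} [CommRing k] [∀ A B d, Module k (H A B d)]

theorem tendsto_entrySum {X : Type*} [AddCommGroup X] [TopologicalSpace X]
    [IsTopologicalAddGroup X] [Module k X] {i : M.1.I}
    {Gs : ι → ∀ j, HPath H (M.1.obj i) (N.1.obj j) → X}
    {G : ∀ j, HPath H (M.1.obj i) (N.1.obj j) → X} (hGs : ∀ n j, IsMultilin k (Gs n j))
    (hGk : ∀ j, IsMultilin k (G j))
    (hG : ∀ j rs r, EntryTendsto l rs r → Tendsto (fun n => Gs n j (rs n)) l (𝓝 (G j r)))
    {qs : ι → HPath (TwHom T) M N} {q : HPath (TwHom T) M N}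
    (hq : PathTendsto (ColTendsto l) qs q) :
    Tendsto (fun n => entrySum T i (qs n) (Gs n)) l (𝓝 (entrySum T i q G)) := by
  induction hq with
  | nil => exact hG _ _ _ (.nil _)
  | @cons L N d fs f qs q hf _ ih =>
    simp only [entrySum_cons]
    refine ih (fun n => isMultilin_entryStep _ (hGs n)) (isMultilin_entryStep _ hGk) ?_
    intro j rs r hr
    obtain ⟨⟨J, h1, h2⟩, h3⟩ := hf j
    rw [entryStep_eq_sum f hGk j r h2]
    simp only [fun n => entryStep_eq_sum (a := M.1.shift i) (fs n) (hGs n) j (rs n) (h1 n)]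
    exact tendsto_finsetSum _ fun j' _ => (hG _ _ _ (.cons (h3 j') hr)).const_smul _

variable [∀ A B d, IsTopologicalAddGroup (H A B d)] {p : ℤ} {φ : RawCochain H}
  {qs : ι → HPath (TwHom T) M N} {q : HPath (TwHom T) M N}

theorem IsContinuous.tendsto_extendTerm (hφ : IsContinuous φ) {i : M.1.I} {j j' : N.1.I}
    {rs : ι → HPath H (M.1.obj i) (N.1.obj j')} {r : HPath H (M.1.obj i) (N.1.obj j')}
    (hr : EntryTendsto l rs r) (e : ℤ) :
    Tendsto (fun n => extendTerm p φ i e j' (rs n) j) l (𝓝 (extendTerm p φ i e j' r j)) := by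
  classical
  simp only [extendTerm, Units.smul_def, DFinsupp.smul_apply]
  refine Tendsto.const_smul ?_ _
  obtain rfl | h := eq_or_ne j' j
  · simpa only [DFinsupp.single_eq_same] using hφ.tendsto hr _
  · simpa only [DFinsupp.single_eq_of_ne h.symm] using tendsto_const_nhds

theorem IsContCochain.tendsto_extend (hφ : IsContCochain k p φ)
    (hq : PathTendsto (ColTendsto l) qs q) (e : ℤ) (i : M.1.I) (j : N.1.I) :
    Tendsto (fun n => extend T p φ M N (qs n) e i j) l (𝓝 (extend T p φ M N q e i j)) := by
  have hm (j') : IsMultilin k fun r : HPath H (M.1.obj i) (N.1.obj j') =>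
      extendTerm p φ i e j' r j :=
    (isMultilin_extendTerm hφ.1 i e j').map (DFinsupp.lapply (R := k)
      (M := fun j : N.1.I => H (M.1.obj i) (N.1.obj j) (e + N.1.shift j - M.1.shift i)) j)
  simp only [extend_apply_entry]
  exact tendsto_entrySum (fun _ => hm) hm (fun j' rs r hr => hφ.2.tendsto_extendTerm hr e) hq

theorem IsContCochain.tendsto_embrTerm (hφ : IsContCochain k p φ) (m : ℕ)
    (hq : PathTendsto (ColTendsto l) qs q) (e : ℤ) (i : M.1.I) (j : N.1.I) :
    Tendsto (fun n => embrTerm T p φ m M N (qs n) e i j) l (𝓝 (embrTerm T p φ m M N q e i j)) := by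
  have h := tendsto_insertSum (l := l) (ps := deltas T m) (Ψs := fun _ ψ => ψ.2) (Ψ := Prod.snd)
    (Gs := fun _ r => extend T p φ M N r e i j) (fun _ _ _ _ _ h => h)
    (fun ψ hψ _ _ qs q hq e => by
      obtain rfl := List.eq_of_mem_replicate hψ
      exact colTendsto_deltaCochain hq e)
    (fun _ _ hr => hφ.tendsto_extend hr e i j) hq
  simpa only [embrTerm, brace_apply_entry, Prod.mk.eta, List.map_id'] using h

end Columns

section GlidingHump

theorem exists_forall_mem_Ico_eq {κ : ℕ → ℕ} (hκ : StrictMono κ) {α : Type*} (ν : ℕ → α) :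
    ∃ s : ℕ → α, ∀ i, ∀ m ∈ Finset.Ico (κ i) (κ (i + 1)), s m = ν i := by
  refine ⟨fun m => ν (Nat.findGreatest (fun i => κ i ≤ m) m), fun i m hm => congrArg ν ?_⟩
  obtain ⟨hi, hm⟩ := Finset.mem_Ico.1 hm
  refine le_antisymm ?_ (Nat.le_findGreatest ((hκ.id_le i).trans hi) hi)
  by_contra! h
  exact hm.not_ge ((hκ.monotone h).trans
    (Nat.findGreatest_of_ne_zero (P := fun i => κ i ≤ m) rfl (by omega)))

variable {X : Type*} [AddCommGroup X] [TopologicalSpace X] [IsTopologicalAddGroup X]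

/-- If the limits `y n` stayed outside a closed neighbourhood of `0` infinitely often, a series
could be put together from pieces, one for each such `n`, whose sums also lie outside it. -/
theorem tendsto_zero_of_selections {g : ℕ → ℕ → X} {c : ℕ} {y : ℕ → X}
    (hg : ∀ n m, c + m < n → g n m = 0)
    (hy : ∀ n, Tendsto (fun K => ∑ m ∈ Finset.range K, g n m) atTop (𝓝 (y n)))
    (hs : ∀ s : ℕ → ℕ, ∃ x, Tendsto (fun K => ∑ m ∈ Finset.range K, g (s m) m) atTop (𝓝 x)) :
    Tendsto y atTop (𝓝 0) := by
  by_contra hcon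
  obtain ⟨W, ⟨hW, hWc⟩, hfr⟩ : ∃ W : Set X, (W ∈ 𝓝 0 ∧ IsClosed W) ∧ ∃ᶠ n in atTop, y n ∉ W := by
    by_contra! h
    refine hcon ((closed_nhds_basis (0 : X)).tendsto_right_iff.2 fun W hW => ?_)
    simpa [Filter.not_frequently] using h W hW
  have hpiece (K₀ : ℕ) : ∃ n K, K₀ < K ∧ ∑ m ∈ Finset.Ico K₀ K, g n m ∉ W := by
    obtain ⟨n, hn, hyn⟩ := frequently_atTop.1 hfr (c + K₀)
    obtain ⟨K, hK, hK'⟩ := (((hy n).eventually (hWc.isOpen_compl.mem_nhds hyn)).and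
      (eventually_gt_atTop K₀)).exists
    refine ⟨n, K, hK', ?_⟩
    rwa [Finset.sum_Ico_eq_sub _ hK'.le, Finset.sum_eq_zero (s := Finset.range K₀) fun m hm =>
      hg n m (by rw [Finset.mem_range] at hm; omega), sub_zero]
  choose ν K hK hνK using hpiece
  let κ : ℕ → ℕ := fun i => K^[i] 0
  have hκ (i : ℕ) : κ (i + 1) = K (κ i) := Function.iterate_succ_apply' K i 0
  have hmono : StrictMono κ := strictMono_nat_of_lt_succ fun i => by rw [hκ]; exact hK _
  obtain ⟨s, hsν⟩ := exists_forall_mem_Ico_eq hmono fun i => ν (κ i)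
  obtain ⟨x, hx⟩ := hs s
  have hpieces : Tendsto (fun i => ∑ m ∈ Finset.Ico (κ i) (κ (i + 1)), g (s m) m) atTop (𝓝 0) := by
    have h := (hx.comp (hmono.tendsto_atTop.comp (tendsto_add_atTop_nat 1))).sub
      (hx.comp hmono.tendsto_atTop)
    rw [sub_self] at h
    exact h.congr fun i => (Finset.sum_Ico_eq_sub _ (hmono.monotone i.le_succ)).symm
  obtain ⟨i, hi⟩ := (hpieces.eventually hW).exists
  rw [Finset.sum_congr rfl fun m hm => by rw [hsν i m hm], hκ] at hi
  exact hνK _ hi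

end GlidingHump

/-! ### Cochains of different arities -/

section ByArity

variable {Ob : Type u} {H : Ob → Ob → ℤ → Type v}

theorem HPath.length_ofFn (n : ℕ) (A : Fin (n + 1) → Ob) (d : Fin n → ℤ)
    (f : ∀ i : Fin n, H (A i.castSucc) (A i.succ) (d i)) : (HPath.ofFn n A d f).length = n := by
  induction n with
  | zero => rfl
  | succ n ih => exact congrArg (· + 1) (ih _ _ _)

/-- The cochain whose component of arity `n` is that of `ρ n`. -/
def byArity (ρ : ℕ → RawCochain H) : RawCochain H := fun A B q => ρ q.length A B q

variable [∀ A B d, AddCommGroup (H A B d)]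

/-- `φ` has only components of arity less than `n`. -/
def HasArityLT (n : ℕ) (φ : RawCochain H) : Prop := ∀ A B, VanishesFrom n (φ A B)

/-- The components of arity less than `n` of a cochain. -/
def truncate (n : ℕ) (φ : RawCochain H) : RawCochain H := byArity fun a => if a < n then φ else 0

variable {n : ℕ} {φ ψ : RawCochain H}

theorem truncate_of_lt {A B : Ob} {q : HPath H A B} (h : q.length < n) :
    truncate n φ A B q = φ A B q := by
  simp [truncate, byArity, h]

theorem hasArityLT_truncate (n : ℕ) (φ : RawCochain H) : HasArityLT n (truncate n φ) :=
  fun A B q hq => by simp [truncate, byArity, hq.not_gt]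

theorem HasArity.hasArityLT {m : ℕ} (h : HasArity m φ) (hm : m < n) : HasArityLT n φ :=
  fun A B q hq => h A B q (by omega)

theorem HasArity.eq_byArity {μ : RawCochain H} (hφ : HasArity n φ)
    (h : ∀ A B (q : HPath H A B), q.length = n → φ A B q = μ A B q) :
    φ = byArity fun a => if a = n then μ else 0 := by
  funext A B q
  by_cases hq : q.length = n
  · simp [byArity, hq, h A B q hq]
  · simp [byArity, hq, hφ A B q hq]

theorem HasArity.add_apply_eq_zero {m : ℕ} (hφ : HasArity m φ) (hψ : HasArity n ψ) {A B : Ob}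
    {q : HPath H A B} (hm : q.length ≠ m) (hn : q.length ≠ n) : (φ + ψ) A B q = 0 := by
  simp only [Pi.add_apply, hφ A B q hm, hψ A B q hn, add_zero]

theorem HasArity.add (hφ : HasArity n φ) (hψ : HasArity n ψ) : HasArity n (φ + ψ) :=
  fun _ _ _ hq => hφ.add_apply_eq_zero hψ hq hq

variable {k : Type*} [CommRing k] [∀ A B d, Module k (H A B d)] {p : ℤ}

theorem HasArityLT.brace {N : ℕ} (h : HasArityLT n φ) (hφ : IsCochain k p φ)
    {ψs : List (ℤ × RawCochain H)} (hψ : ∀ ψ ∈ ψs, HasArityLT N ψ.2) :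
    HasArityLT (n + ψs.length * N) (brace φ ψs) := fun A B q hq => funext fun e =>
  VanishesFrom.insertSum (fun ψ hm A B e r hr => congrFun (hψ ψ hm A B r hr) e)
    (hφ.isMultilin A B e) (fun r hr => congrFun (h A B r hr) e) q hq

theorem LinRel.length {c : k} {A B : Ob} {q q' q'' : HPath H A B} (h : LinRel c q q' q'') :
    q.length = q''.length ∧ q'.length = q''.length := by
  induction h with
  | head => simp [HPath.length]
  | tail f _ ih => simp [HPath.length, ih]

theorem IsCochain.byArity {ρ : ℕ → RawCochain H} (h : ∀ n, IsCochain k p (ρ n)) :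
    IsCochain k p (byArity ρ) := by
  refine isCochain_iff.2 ⟨fun A B q e he => (h _).eq_zero _ _ _ _ he, fun A B e c q q' q'' hq => ?_⟩
  simp only [TwistedObjects.byArity, hq.length.1, hq.length.2]
  exact (h _).isMultilin A B e c q q' q'' hq

theorem IsCochain.zero (p : ℤ) : IsCochain k p (0 : RawCochain H) :=
  isCochain_iff.2 ⟨fun _ _ _ _ _ => rfl, fun _ _ _ => IsMultilin.zero⟩

theorem IsCochain.add (hφ : IsCochain k p φ) (hψ : IsCochain k p ψ) : IsCochain k p (φ + ψ) :=
  isCochain_iff.2 ⟨fun A B q e he => by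
    simp only [Pi.add_apply, hφ.eq_zero _ _ _ _ he, hψ.eq_zero _ _ _ _ he, add_zero],
    fun A B e => (hφ.isMultilin A B e).add (hψ.isMultilin A B e)⟩

theorem IsCochain.smul (hφ : IsCochain k p φ) (c : k) : IsCochain k p (c • φ) :=
  isCochain_iff.2 ⟨fun A B q e he => by
    simp only [Pi.smul_apply, hφ.eq_zero _ _ _ _ he, smul_zero],
    fun A B e => (hφ.isMultilin A B e).smul c⟩

variable [∀ A B d, TopologicalSpace (H A B d)]

namespace IsContCochain

theorem byArity {ρ : ℕ → RawCochain H} (h : ∀ n, IsContCochain k p (ρ n)) :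
    IsContCochain k p (byArity ρ) := by
  refine ⟨IsCochain.byArity fun n => (h n).1, fun n A d e => ?_⟩
  simp only [TwistedObjects.byArity, HPath.length_ofFn]
  exact (h n).2 n A d e

theorem zero (p : ℤ) : IsContCochain k p (0 : RawCochain H) :=
  ⟨IsCochain.zero p, fun _ _ _ _ => continuous_const⟩

theorem truncate (h : IsContCochain k p φ) (n : ℕ) : IsContCochain k p (truncate n φ) :=
  byArity fun a => by
    split_ifs
    · exact h
    · exact zero p

theorem smul [∀ A B d, ContinuousConstSMul k (H A B d)] (hφ : IsContCochain k p φ) (c : k) :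
    IsContCochain k p (c • φ) :=
  ⟨hφ.1.smul c, fun n A d e => (hφ.2 n A d e).const_smul c⟩

variable [∀ A B d, IsTopologicalAddGroup (H A B d)]

theorem add (hφ : IsContCochain k p φ) (hψ : IsContCochain k p ψ) : IsContCochain k p (φ + ψ) :=
  ⟨hφ.1.add hψ.1, fun n A d e => (hφ.2 n A d e).add (hψ.2 n A d e)⟩

theorem neg (hφ : IsContCochain k p φ) : IsContCochain k p (-φ) :=
  ⟨by simpa using hφ.1.smul (-1), fun n A d e => (hφ.2 n A d e).neg⟩

theorem sub (hφ : IsContCochain k p φ) (hψ : IsContCochain k p ψ) : IsContCochain k p (φ - ψ) :=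
  sub_eq_add_neg φ ψ ▸ hφ.add hψ.neg

end IsContCochain

theorem HasArity.isContCochain {μ : RawCochain H} (hφ : HasArity n φ) (hμ : IsContCochain k p μ)
    (h : ∀ A B (q : HPath H A B), q.length = n → φ A B q = μ A B q) : IsContCochain k p φ := by
  rw [hφ.eq_byArity h]
  refine .byArity fun a => ?_
  split_ifs
  · exact hμ
  · exact .zero p

end ByArity

/-! ### The map `embr_δ` -/

section EmbrTerm

variable {Ob : Type u} {H : Ob → Ob → ℤ → Type v} [∀ A B d, AddCommGroup (H A B d)]
  {k : Type*} [CommRing k] [∀ A B d, Module k (H A B d)] {T : Set (TwObj.{u, v, w} H)}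
  {p : ℤ} {φ ψ : RawCochain H} {m n : ℕ} {M N : T} {q : HPath (TwHom T) M N}

theorem extend_add (p : ℤ) (φ ψ : RawCochain H) :
    extend T p (φ + ψ) = extend T p φ + extend T p ψ := by
  classical
  funext M N q e i
  refine Eq.trans (entrySum_congr fun j r _ _ => ?_) (entrySum_add q _ _)
  simp only [Pi.add_apply, DFinsupp.single_add, smul_add]

theorem extend_smul (p : ℤ) (c : k) (φ : RawCochain H) :
    extend T p (c • φ) = c • extend T p φ := by
  classical
  funext M N q e i
  refine Eq.trans (entrySum_congr fun j r _ _ => ?_) (entrySum_smul q _ c)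
  simp only [Pi.smul_apply, DFinsupp.single_smul, smul_comm c]

theorem extend_zero (p : ℤ) : extend T p (0 : RawCochain H) = 0 := by
  simpa using extend_add (T := T) p (0 : RawCochain H) 0

theorem extend_congr
    (h : ∀ A B (r : HPath H A B), r.length = q.length → φ A B r = ψ A B r) (e : ℤ) :
    extend T p φ M N q e = extend T p ψ M N q e :=
  funext fun i => entrySum_congr fun j r _ hr => by rw [h _ _ r hr]

theorem HasArityLT.extend (h : HasArityLT n φ) (p : ℤ) : HasArityLT n (extend T p φ) :=
  fun M N q hq => funext fun e => (extend_congr (fun A B r hr => h A B r (hr ▸ hq)) e).trans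
    (congrFun (congrFun (congrFun (congrFun (extend_zero p) M) N) q) e)

theorem embrTerm_eq_insertPow (p : ℤ) (φ : RawCochain H) (m : ℕ) (q : HPath (TwHom T) M N)
    (e : ℤ) : embrTerm T p φ m M N q e
      = insertPow (deltaCochain T) m (fun r => extend T p φ M N r e) q := rfl

theorem embrTerm_zero (p : ℤ) (φ : RawCochain H) : embrTerm T p φ 0 = extend T p φ := by
  funext M N q e
  rw [embrTerm_eq_insertPow, insertPow_zero]

theorem embrTerm_add (p : ℤ) (φ ψ : RawCochain H) (m : ℕ) :
    embrTerm T p (φ + ψ) m = embrTerm T p φ m + embrTerm T p ψ m := by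
  funext M N q e
  simp only [Pi.add_apply, embrTerm_eq_insertPow, extend_add]
  exact insertSum_add _ _ _ _

theorem embrTerm_smul (p : ℤ) (c : k) (φ : RawCochain H) (m : ℕ) :
    embrTerm T p (c • φ) m = c • embrTerm T p φ m := by
  funext M N q e
  simp only [Pi.smul_apply, embrTerm_eq_insertPow, extend_smul (k := k)]
  exact insertSum_smul _ _ _ _

theorem IsCochain.embrTerm (hφ : IsCochain k p φ) (m : ℕ) : IsCochain k p (embrTerm T p φ m) := by
  have h := (IsCochain.extend (T := T) hφ).brace (ψs := deltas T m) fun ψ hψ => by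
    obtain rfl := List.eq_of_mem_replicate hψ
    exact isCochain_deltaCochain T
  simp only [deltas, List.map_replicate, List.sum_replicate, smul_zero, add_zero] at h
  exact h

theorem embrTerm_congr (hφ : IsCochain k p φ) (hψ : IsCochain k p ψ)
    (h : ∀ A B (r : HPath H A B), r.length = q.length + m → φ A B r = ψ A B r) :
    embrTerm T p φ m M N q = embrTerm T p ψ m M N q := funext fun e =>
  insertPow_congr hasArity_deltaCochain (hφ.extend.isMultilin M N e) (hψ.extend.isMultilin M N e)
    fun _ hr => extend_congr (fun A B s hs => h A B s (hs.trans hr)) e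

theorem embrTerm_apply_eq_zero (hφ : IsCochain k p φ)
    (h : ∀ A B (r : HPath H A B), r.length = q.length + m → φ A B r = 0) :
    embrTerm T p φ m M N q = 0 := by
  have h0 : TwistedObjects.embrTerm T p (0 : RawCochain H) m = 0 := by
    simpa using embrTerm_add (T := T) p (0 : RawCochain H) 0 m
  rw [embrTerm_congr hφ (.zero p) h, h0]
  rfl

theorem HasArity.embrTerm {a : ℕ} (hφ : HasArity a φ) (hc : IsCochain k p φ) (h : n + m = a) :
    HasArity n (embrTerm T p φ m) := fun _ _ _ hq =>
  embrTerm_apply_eq_zero hc fun A B r hr => hφ A B r (by omega)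

theorem HasArity.extend (hφ : HasArity n φ) (hc : IsCochain k p φ) : HasArity n (extend T p φ) :=
  embrTerm_zero (T := T) p φ ▸ hφ.embrTerm hc rfl

end EmbrTerm

section Embr

variable {Ob : Type u} {H : Ob → Ob → ℤ → Type v} [∀ A B d, AddCommGroup (H A B d)]
  {k : Type*} [CommRing k] [∀ A B d, Module k (H A B d)] {T : Set (TwObj.{u, v, w} H)}
  [∀ A B d, TopologicalSpace (H A B d)] [∀ A B d, T2Space (H A B d)] {p : ℤ}
  {φ ψ : RawCochain H} {ψs : List (ℤ × RawCochain H)} {n : ℕ} {M N : T}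

theorem finsum_single_apply {ι : Type*} [DecidableEq ι] {β : ι → Type*} [∀ j, AddCommMonoid (β j)]
    {f : ∀ j, β j} {J : Finset ι} (hf : ∀ j ∉ J, f j = 0) (j : ι) :
    (∑ᶠ j, DFinsupp.single j (f j)) j = f j := by
  have hJ : (Function.support fun j => DFinsupp.single j (f j)) ⊆ J := fun j hj => by
    by_contra hjJ
    exact hj (by simp [hf j hjJ])
  rw [finsum_eq_sum_of_support_subset _ hJ, DFinsupp.finsetSum_apply]
  by_cases hj : j ∈ J
  · rw [Finset.sum_eq_single_of_mem j hj fun j' _ hne => DFinsupp.single_eq_of_ne hne.symm,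
      DFinsupp.single_eq_same]
  · rw [hf j hj]
    exact Finset.sum_eq_zero fun j' hj' => DFinsupp.single_eq_of_ne fun h => hj (h ▸ hj')

namespace IsTwistedQuiver

theorem pointwiseHasSum (hT : IsTwistedQuiver T k) (hφ : IsContCochain k p φ) :
    PointwiseHasSum T (embrTerm T p φ) (embr T p φ) := by
  classical
  intro M N q e i
  obtain ⟨⟨J, hJ⟩, hlim⟩ := hT p φ hφ M N q e i
  refine ⟨⟨J, hJ⟩, fun j => ?_⟩
  have h0 : ∀ j ∉ J,
      (limUnder atTop fun n => ∑ m ∈ Finset.range n, embrTerm T p φ m M N q e i j) = 0 :=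
    fun j hj => by
      simp only [fun m => hJ m j hj, Finset.sum_const_zero]
      exact tendsto_const_nhds.limUnder_eq
  obtain ⟨x, hx⟩ := hlim j
  rw [embr, finsum_single_apply h0, hx.limUnder_eq]
  exact hx

theorem tendsto_embr (hT : IsTwistedQuiver T k) (hφ : IsContCochain k p φ)
    (q : HPath (TwHom T) M N) (e : ℤ) (i : M.1.I) (j : N.1.I) :
    Tendsto (fun n => ∑ m ∈ Finset.range n, embrTerm T p φ m M N q e i j) atTop
      (𝓝 (embr T p φ M N q e i j)) :=
  (hT.pointwiseHasSum hφ M N q e i).2 j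

theorem embr_eq_sum (hT : IsTwistedQuiver T k) (hφ : IsContCochain k p φ)
    (q : HPath (TwHom T) M N) (e : ℤ) {L : ℕ} (h : ∀ m, L ≤ m → embrTerm T p φ m M N q e = 0) :
    embr T p φ M N q e = ∑ m ∈ Finset.range L, embrTerm T p φ m M N q e := by
  funext i
  ext j
  refine tendsto_nhds_unique (hT.tendsto_embr hφ q e i j) (tendsto_const_nhds.congr' ?_)
  filter_upwards [eventually_ge_atTop L] with n hn
  rw [Finset.sum_apply, DFinsupp.finsetSum_apply]
  refine Finset.sum_subset (Finset.range_subset_range.2 hn) fun m _ hm => ?_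
  rw [h m (by simpa using hm)]
  rfl

theorem embr_eq_sum_of_hasArityLT (hT : IsTwistedQuiver T k) (hφ : IsContCochain k p φ)
    (h : HasArityLT n φ) (q : HPath (TwHom T) M N) (e : ℤ) {L : ℕ} (hL : n ≤ q.length + L) :
    embr T p φ M N q e = ∑ m ∈ Finset.range L, embrTerm T p φ m M N q e :=
  hT.embr_eq_sum hφ q e fun _ _ =>
    congrFun (embrTerm_apply_eq_zero hφ.1 fun A B r hr => h A B r (by omega)) e

theorem hasArityLT_embr (hT : IsTwistedQuiver T k) (hφ : IsContCochain k p φ)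
    (h : HasArityLT n φ) : HasArityLT n (embr T p φ) := fun _ _ q hq => funext fun e =>
  hT.embr_eq_sum_of_hasArityLT hφ h q e (L := 0) hq

theorem embr_smul [∀ A B d, ContinuousConstSMul k (H A B d)] (hT : IsTwistedQuiver T k) (c : k)
    (hφ : IsContCochain k p φ) : embr T p (c • φ) = c • embr T p φ := by
  funext M N q e i
  ext j
  refine tendsto_nhds_unique (hT.tendsto_embr (hφ.smul c) q e i j) ?_
  refine ((hT.tendsto_embr hφ q e i j).const_smul c).congr fun n => ?_
  simp only [embrTerm_smul, Pi.smul_apply, DFinsupp.smul_apply, Finset.smul_sum]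

theorem embr_zero (hT : IsTwistedQuiver T k) (p : ℤ) : embr T p (0 : RawCochain H) = 0 :=
  funext fun _ => funext fun _ => funext fun q =>
    hT.hasArityLT_embr (n := 0) (.zero p) (fun _ _ _ _ => rfl) _ _ q (Nat.zero_le _)

theorem embr_truncate (hT : IsTwistedQuiver T k) (hφ : IsContCochain k p φ) (n : ℕ)
    (q : HPath (TwHom T) M N) (e : ℤ) :
    embr T p (truncate n φ) M N q e
      = ∑ m ∈ Finset.range (n - q.length), embrTerm T p φ m M N q e := by
  rw [hT.embr_eq_sum_of_hasArityLT (hφ.truncate n) (hasArityLT_truncate n φ) q e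
    (L := n - q.length) (by omega)]
  refine Finset.sum_congr rfl fun m hm => ?_
  rw [Finset.mem_range] at hm
  exact congrFun (embrTerm_congr (hφ.truncate n).1 hφ.1
    fun A B r hr => truncate_of_lt (by omega)) e

theorem colTendsto_embr_truncate (hT : IsTwistedQuiver T k) (hφ : IsContCochain k p φ)
    (q : HPath (TwHom T) M N) (e : ℤ) :
    ColTendsto atTop M N e (fun n => embr T p (truncate n φ) M N q e) (embr T p φ M N q e) := by
  intro i
  obtain ⟨⟨J, hJ⟩, h⟩ := hT.pointwiseHasSum hφ M N q e i
  have hsum (n : ℕ) (j : N.1.I) : embr T p (truncate n φ) M N q e i j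
      = ∑ m ∈ Finset.range (n - q.length), embrTerm T p φ m M N q e i j := by
    rw [hT.embr_truncate hφ, Finset.sum_apply, DFinsupp.finsetSum_apply]
  refine ⟨⟨J, fun n j hj => ?_, fun j hj => ?_⟩, fun j => ?_⟩
  · rw [hsum]
    exact Finset.sum_eq_zero fun m _ => hJ m j hj
  · refine tendsto_nhds_unique (h j) ?_
    simp only [fun m => hJ m j hj, Finset.sum_const_zero]
    exact tendsto_const_nhds
  · simp only [hsum]
    exact (h j).comp (tendsto_sub_atTop_nat _)

variable [∀ A B d, IsTopologicalAddGroup (H A B d)]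

theorem embr_add (hT : IsTwistedQuiver T k) (hφ : IsContCochain k p φ)
    (hψ : IsContCochain k p ψ) : embr T p (φ + ψ) = embr T p φ + embr T p ψ := by
  funext M N q e i
  ext j
  refine tendsto_nhds_unique (hT.tendsto_embr (hφ.add hψ) q e i j) ?_
  refine ((hT.tendsto_embr hφ q e i j).add (hT.tendsto_embr hψ q e i j)).congr fun n => ?_
  simp only [embrTerm_add, Pi.add_apply, DFinsupp.add_apply, Finset.sum_add_distrib]

theorem embr_sub (hT : IsTwistedQuiver T k) (hφ : IsContCochain k p φ)
    (hψ : IsContCochain k p ψ) : embr T p (φ - ψ) = embr T p φ - embr T p ψ := by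
  rw [eq_sub_iff_add_eq, ← hT.embr_add (hφ.sub hψ) hψ, sub_add_cancel]

theorem isCochain_embr [∀ A B d, ContinuousConstSMul k (H A B d)] (hT : IsTwistedQuiver T k)
    (hφ : IsContCochain k p φ) : IsCochain k p (embr T p φ) := by
  refine isCochain_iff.2 ⟨fun M N q e he => ?_, fun M N e c q q' q'' h => ?_⟩
  · exact hT.embr_eq_sum hφ q e (L := 0) fun m _ => (hφ.1.embrTerm m).eq_zero _ _ _ _ he
  · funext i
    ext j
    refine tendsto_nhds_unique (hT.tendsto_embr hφ q'' e i j) ?_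
    refine ((hT.tendsto_embr hφ q e i j).add
      ((hT.tendsto_embr hφ q' e i j).const_smul c)).congr fun n => ?_
    rw [Finset.smul_sum, ← Finset.sum_add_distrib]
    refine Finset.sum_congr rfl fun m _ => ?_
    exact (congrArg (fun f : TwHom T M N e => f i j)
      ((hφ.1.embrTerm (T := T) m).isMultilin M N e c q q' q'' h)).symm

theorem tendsto_embr_zero (hT : IsTwistedQuiver T k) {ρ : ℕ → RawCochain H}
    (hρ : ∀ n, IsContCochain k p (ρ n))
    (h0 : ∀ n A B (r : HPath H A B), r.length < n → ρ n A B r = 0)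
    (q : HPath (TwHom T) M N) (e : ℤ) (i : M.1.I) (j : N.1.I) :
    Tendsto (fun n => embr T p (ρ n) M N q e i j) atTop (𝓝 0) := by
  refine tendsto_zero_of_selections (c := q.length)
    (g := fun n m => embrTerm T p (ρ n) m M N q e i j) (fun n m hm => ?_)
    (fun n => hT.tendsto_embr (hρ n) q e i j) fun s => ?_
  · rw [embrTerm_apply_eq_zero (hρ n).1 fun A B r hr => h0 n A B r (by omega)]
    rfl
  · have hθ : IsContCochain k p (byArity fun a => ρ (s (a - q.length))) := .byArity fun n => hρ _
    refine ⟨_, (hT.tendsto_embr hθ q e i j).congr fun K => Finset.sum_congr rfl fun m _ => ?_⟩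
    rw [embrTerm_congr hθ.1 (hρ (s m)).1 fun A B r hr => ?_]
    simp only [byArity, hr, Nat.add_sub_cancel_left]

theorem tendsto_embr_of_eq (hT : IsTwistedQuiver T k) {φs : ℕ → RawCochain H}
    (hφs : ∀ n, IsContCochain k p (φs n)) (hφ : IsContCochain k p φ)
    (h : ∀ n A B (r : HPath H A B), r.length < n → φs n A B r = φ A B r)
    (q : HPath (TwHom T) M N) (e : ℤ) (i : M.1.I) (j : N.1.I) :
    Tendsto (fun n => embr T p (φs n) M N q e i j) atTop (𝓝 (embr T p φ M N q e i j)) := by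
  have h0 := hT.tendsto_embr_zero (fun n => (hφs n).sub hφ)
    (fun n A B r hr => sub_eq_zero.2 (h n A B r hr)) q e i j
  simp only [fun n => hT.embr_sub (hφs n) hφ] at h0
  simpa using h0.add_const (embr T p φ M N q e i j)

end IsTwistedQuiver

end Embr

/-! ### Compatibility of `embr_δ` with braces -/

section Brace

variable {Ob : Type u} {H : Ob → Ob → ℤ → Type v} [∀ A B d, AddCommGroup (H A B d)]
  {k : Type*} [CommRing k] [∀ A B d, Module k (H A B d)] {T : Set (TwObj.{u, v, w} H)}
  [∀ A B d, TopologicalSpace (H A B d)] {p : ℤ} {φ : RawCochain H}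
  {ψs : List (ℤ × RawCochain H)} {n : ℕ} {M N : T}

theorem isContCochain_brace_truncate [∀ A B d, IsTopologicalAddGroup (H A B d)]
    (hφ : IsContCochain k p φ) (hψ : ∀ ψ ∈ ψs, IsContCochain k ψ.1 ψ.2) (n : ℕ) :
    IsContCochain k (p + (ψs.map Prod.fst).sum)
      (brace φ (ψs.map fun ψ => (ψ.1, truncate n ψ.2))) := by
  have h := hφ.brace (ψs := ψs.map fun ψ => (ψ.1, truncate n ψ.2)) fun ψ' h' => by
    obtain ⟨ψ, hψs, rfl⟩ := List.mem_map.1 h'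
    exact (hψ ψ hψs).truncate n
  simpa only [List.map_map, Function.comp_def] using h

variable [∀ A B d, T2Space (H A B d)]

theorem IsTwistedQuiver.embr_eq_expCochain (hT : IsTwistedQuiver T k) (hφ : IsContCochain k p φ)
    (h : HasArityLT n φ) {L : ℕ} (hL : n ≤ L) :
    embr T p φ = expCochain (deltaCochain T) L (extend T p φ) := by
  funext M N q e
  exact hT.embr_eq_sum_of_hasArityLT hφ h q e (by omega)

variable [∀ A B d, IsTopologicalAddGroup (H A B d)]

namespace IsTwistedQuiver

theorem embr_brace_of_hasArityLT (hT : IsTwistedQuiver T k) (hφ : IsContCochain k p φ)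
    (hn : HasArityLT n φ) (hψ : ∀ ψ ∈ ψs, IsContCochain k ψ.1 ψ.2) {N : ℕ}
    (hN : ∀ ψ ∈ ψs, HasArityLT N ψ.2) :
    embr T (p + (ψs.map Prod.fst).sum) (brace φ ψs)
      = brace (embr T p φ) (ψs.map fun ψ => (ψ.1, embr T ψ.1 ψ.2)) := by
  set L := n + ψs.length * N
  have hembr : (ψs.map fun ψ => (ψ.1, embr T ψ.1 ψ.2))
      = (ψs.map fun ψ => (ψ.1, extend T ψ.1 ψ.2)).map fun Ψ =>
        (Ψ.1, expCochain (deltaCochain T) L Ψ.2) := by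
    rw [List.map_map]
    refine List.map_congr_left fun ψ h => ?_
    have hNL : N ≤ L := (Nat.le_mul_of_pos_left N (List.length_pos_of_mem h)).trans
      (Nat.le_add_left _ _)
    rw [Function.comp_apply, hT.embr_eq_expCochain (hψ ψ h) (hN ψ h) hNL]
  rw [hT.embr_eq_expCochain (hφ.brace hψ) (hn.brace hφ.1 hN) le_rfl,
    extend_brace hφ.1, hembr,
    hT.embr_eq_expCochain hφ hn (L := L) (Nat.le_add_right n _)]
  funext A B q e
  refine insertExp_insertSum (N := N) hasArity_deltaCochain
    (List.forall_mem_map.2 fun ψ h => (hψ ψ h).1.extend.isMultilin)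
    (List.forall_mem_map.2 fun ψ h A B e r hr => congrFun ((hN ψ h).extend _ A B r hr) e)
    (hφ.1.extend.isMultilin A B e) (fun r hr => congrFun (hn.extend p A B r hr) e) ?_ q
  rw [List.length_map]

theorem tendsto_embr_path (hT : IsTwistedQuiver T k) (hφ : IsContCochain k p φ)
    (h : HasArityLT n φ) {ι : Type*} {l : Filter ι} {qs : ι → HPath (TwHom T) M N}
    {q : HPath (TwHom T) M N} (hq : PathTendsto (ColTendsto l) qs q) (e : ℤ) (i : M.1.I)
    (j : N.1.I) :
    Tendsto (fun x => embr T p φ M N (qs x) e i j) l (𝓝 (embr T p φ M N q e i j)) := by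
  have hsum (r : HPath (TwHom T) M N) :
      embr T p φ M N r e i j = ∑ m ∈ Finset.range n, embrTerm T p φ m M N r e i j := by
    rw [hT.embr_eq_sum_of_hasArityLT hφ h r e (Nat.le_add_left n _), Finset.sum_apply,
      DFinsupp.finsetSum_apply]
  simp only [hsum]
  exact tendsto_finsetSum _ fun m _ => hφ.tendsto_embrTerm m hq e i j

theorem embr_brace_of_hasArityLT_left (hT : IsTwistedQuiver T k) (hφ : IsContCochain k p φ)
    (hn : HasArityLT n φ) (hψ : ∀ ψ ∈ ψs, IsContCochain k ψ.1 ψ.2) :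
    embr T (p + (ψs.map Prod.fst).sum) (brace φ ψs)
      = brace (embr T p φ) (ψs.map fun ψ => (ψ.1, embr T ψ.1 ψ.2)) := by
  funext M N q e i
  ext j
  have htrunc (a : ℕ) : embr T (p + (ψs.map Prod.fst).sum)
      (brace φ (ψs.map fun ψ => (ψ.1, truncate a ψ.2)))
      = brace (embr T p φ) (ψs.map fun ψ => (ψ.1, embr T ψ.1 (truncate a ψ.2))) := by
    have h := hT.embr_brace_of_hasArityLT (ψs := ψs.map fun ψ => (ψ.1, truncate a ψ.2)) hφ hn
      (List.forall_mem_map.2 fun ψ h => (hψ ψ h).truncate a)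
      (List.forall_mem_map.2 fun ψ _ => hasArityLT_truncate a ψ.2)
    simpa only [List.map_map, Function.comp_def] using h
  have hembr := hT.tendsto_embr_of_eq (fun a => isContCochain_brace_truncate hφ hψ a) (hφ.brace hψ)
    (fun a A B r hr => funext fun e => by
      have h := insertSum_map_congr (G := fun s => φ A B s e) (ps := ψs)
        (Ψ := fun ψ => truncate a ψ.2) (Ψ' := Prod.snd) (q := r) le_rfl
        fun ψ _ A B s hs => truncate_of_lt (hs.trans_lt hr)
      simpa only [brace_eq_insertSum, Prod.mk.eta, List.map_id'] using h) q e i j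
  have hbrace := tendsto_insertSum (l := atTop) (ps := ψs)
    (Ψs := fun a ψ => embr T ψ.1 (truncate a ψ.2)) (Ψ := fun ψ => embr T ψ.1 ψ.2)
    (Gs := fun _ r => embr T p φ M N r e i j)
    (c := fun _ _ _ fs f => fs = fun _ => f) (c' := ColTendsto (T := T) atTop)
    (fun _ _ _ fs f h => h ▸ colTendsto_const f)
    (fun ψ h A B rs r hr e => hr.eq_const ▸ hT.colTendsto_embr_truncate (hψ ψ h) r e)
    (fun rs r hr => hT.tendsto_embr_path hφ hn hr e i j) (.const q)
  simp only [htrunc, brace_apply_entry] at hembr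
  rw [brace_apply_entry]
  exact tendsto_nhds_unique hembr hbrace

theorem embr_brace (hT : IsTwistedQuiver T k) (hφ : IsContCochain k p φ)
    (hψ : ∀ ψ ∈ ψs, IsContCochain k ψ.1 ψ.2) :
    embr T (p + (ψs.map Prod.fst).sum) (brace φ ψs)
      = brace (embr T p φ) (ψs.map fun ψ => (ψ.1, embr T ψ.1 ψ.2)) := by
  funext M N q e i
  ext j
  have hembr := hT.tendsto_embr_of_eq
    (fun a => (hφ.truncate (a + ψs.length)).brace hψ) (hφ.brace hψ)
    (fun a A B r hr => funext fun e => by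
      simp only [brace_eq_insertSum]
      exact insertSum_congr fun s _ hs => congrFun (truncate_of_lt (by omega)) e) q e i j
  have hbrace := tendsto_insertSum_of_forall (ψs := ψs.map fun ψ => (ψ.1, embr T ψ.1 ψ.2))
    (fun r => ((hT.colTendsto_embr_truncate hφ r e i).2 j).comp
      (tendsto_add_atTop_nat ψs.length)) q
  simp only [fun a => hT.embr_brace_of_hasArityLT_left (hφ.truncate a)
    (hasArityLT_truncate a φ) hψ, brace_apply_entry] at hembr
  rw [brace_apply_entry]
  exact tendsto_nhds_unique hembr hbrace

end IsTwistedQuiver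

end Brace

/-! ### Transport of structures -/

section Structures

variable {Ob : Type u} {H : Ob → Ob → ℤ → Type v} [∀ A B d, AddCommGroup (H A B d)]
  {k : Type*} [CommRing k] [∀ A B d, Module k (H A B d)] {T : Set (TwObj.{u, v, w} H)}
  [∀ A B d, TopologicalSpace (H A B d)] {p : ℤ} {μ φ c d m : RawCochain H} {n : ℕ}

theorem isContCochain_components (hc : HasArity 0 c) (hd : HasArity 1 d) (hm : HasArity 2 m)
    (h : IsContCochain k p (c + d + m)) :
    IsContCochain k p c ∧ IsContCochain k p d ∧ IsContCochain k p m := by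
  refine ⟨hc.isContCochain h fun A B q hq => ?_, hd.isContCochain h fun A B q hq => ?_,
    hm.isContCochain h fun A B q hq => ?_⟩ <;> simp only [Pi.add_apply]
  · rw [hd A B q (by omega), hm A B q (by omega), add_zero, add_zero]
  · rw [hc A B q (by omega), hm A B q (by omega), zero_add, add_zero]
  · rw [hc A B q (by omega), hd A B q (by omega), zero_add, zero_add]

variable [∀ A B d, T2Space (H A B d)]

namespace IsTwistedQuiver

theorem embr_eq_sum_embrTerm (hT : IsTwistedQuiver T k) (hφ : IsContCochain k p φ)
    (h : HasArityLT n φ) : embr T p φ = ∑ m ∈ Finset.range n, embrTerm T p φ m := by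
  funext M N q e
  simp only [hT.embr_eq_sum_of_hasArityLT hφ h q e (Nat.le_add_left n _), Finset.sum_apply]

theorem embr_of_hasArity_zero (hT : IsTwistedQuiver T k) (hc : IsContCochain k p c)
    (h : HasArity 0 c) : embr T p c = extend T p c := by
  rw [hT.embr_eq_sum_embrTerm hc (h.hasArityLT Nat.zero_lt_one), Finset.sum_range_one,
    embrTerm_zero]

theorem embr_of_hasArity_one (hT : IsTwistedQuiver T k) (hd : IsContCochain k p d)
    (h : HasArity 1 d) : embr T p d = extend T p d + brace (extend T p d) (deltas T 1) := by
  rw [hT.embr_eq_sum_embrTerm hd (h.hasArityLT Nat.one_lt_two), Finset.sum_range_succ,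
    Finset.sum_range_one, embrTerm_zero, embrTerm]

theorem embr_of_hasArity_two (hT : IsTwistedQuiver T k) (hm : IsContCochain k p m)
    (h : HasArity 2 m) :
    embr T p m = extend T p m + brace (extend T p m) (deltas T 1)
      + brace (extend T p m) (deltas T 2) := by
  rw [hT.embr_eq_sum_embrTerm hm (h.hasArityLT (Nat.lt_succ_self 2)), Finset.sum_range_succ,
    Finset.sum_range_succ, Finset.sum_range_one, embrTerm_zero, embrTerm, embrTerm]

variable [∀ A B d, IsTopologicalAddGroup (H A B d)]

theorem embr_of_hasArity_le_two (hT : IsTwistedQuiver T k) (hcc : IsContCochain k p c)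
    (hdc : IsContCochain k p d) (hmc : IsContCochain k p m) (hc : HasArity 0 c)
    (hd : HasArity 1 d) (hm : HasArity 2 m) :
    embr T p (c + d + m)
      = (extend T p c + brace (extend T p d) (deltas T 1) + brace (extend T p m) (deltas T 2))
        + (extend T p d + brace (extend T p m) (deltas T 1)) + extend T p m := by
  rw [hT.embr_add (hcc.add hdc) hmc, hT.embr_add hcc hdc, hT.embr_of_hasArity_zero hcc hc,
    hT.embr_of_hasArity_one hdc hd, hT.embr_of_hasArity_two hmc hm]
  abel

theorem embr_of_curvature_eq_zero (hT : IsTwistedQuiver T k) (hdc : IsContCochain k p d)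
    (hmc : IsContCochain k p m) (hd : HasArity 1 d) (hm : HasArity 2 m)
    (h : brace (extend T p d) (deltas T 1) + brace (extend T p m) (deltas T 2) = 0) :
    embr T p (d + m)
      = (extend T p d + brace (extend T p m) (deltas T 1)) + extend T p m := by
  simpa only [zero_add, extend_zero, h] using
    hT.embr_of_hasArity_le_two (.zero p) hdc hmc (fun _ _ _ _ => rfl) hd hm

variable [∀ A B d, ContinuousConstSMul k (H A B d)]

theorem isAInftyStructure_embr (hT : IsTwistedQuiver T k) (hμ : IsContinuous μ)
    (h : IsAInftyStructure k μ) : IsAInftyStructure k (embr T 1 μ) := by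
  have hμc : IsContCochain k 1 μ := ⟨h.1, hμ⟩
  have hbrace := hT.embr_brace hμc (ψs := [(1, μ)]) (by simpa using hμc)
  rw [h.2, hT.embr_zero] at hbrace
  exact ⟨hT.isCochain_embr hμc, hbrace.symm⟩

theorem embr_opD (hT : IsTwistedQuiver T k) (hμ : IsContCochain k 1 μ)
    {φs : List (ℤ × RawCochain H)} (hφ : ∀ φ ∈ φs, IsContCochain k φ.1 φ.2) :
    embr T (1 + (φs.map Prod.fst).sum) (opD μ φs)
      = opD (embr T 1 μ) (φs.map fun φ => (φ.1, embr T φ.1 φ.2)) := by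
  match φs, hφ with
  | [], _ => exact hT.embr_zero _
  | [φ], hφ =>
    have hφc : IsContCochain k φ.1 φ.2 := hφ φ (List.mem_singleton_self φ)
    have hμs : ∀ ψ ∈ [((1 : ℤ), μ)], IsContCochain k ψ.1 ψ.2 := by simpa using hμ
    have hμφ := hT.embr_brace hμ hφ
    have hφμ := hT.embr_brace hφc hμs
    have hμφc := hμ.brace hφ
    have hφμc := hφc.brace hμs
    simp only [List.map_cons, List.map_nil, List.sum_cons, List.sum_nil, add_zero,
      add_comm φ.1 1] at hμφ hφμ hμφc hφμc
    simp only [opD, List.map_cons, List.map_nil, List.sum_cons, List.sum_nil, add_zero,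
      Units.smul_def, ← Int.cast_smul_eq_zsmul k]
    rw [hT.embr_sub hμφc (hφμc.smul _), hT.embr_smul _ hφμc, hμφ, hφμ]
  | φ :: ψ :: φs, hφ => exact hT.embr_brace hμ hφ

theorem isBInftyMorphism_embr (hT : IsTwistedQuiver T k) (hμ : IsContCochain k 1 μ) :
    IsBInftyMorphism k (IsContCochain k) (IsCochain k) μ (embr T 1 μ) (embr T) where
  map_mem _ _ hφ := hT.isCochain_embr hφ
  map_add _ _ _ hφ hψ := hT.embr_add hφ hψ
  map_smul _ a _ hφ := hT.embr_smul a hφ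
  map_brace _ _ _ hφ hψ := hT.embr_brace hφ hψ
  map_opD _ hφ := hT.embr_opD hμ hφ

theorem isCdgStructure_embr (hT : IsTwistedQuiver T k) (hμ : IsContinuous μ)
    (h : IsCdgStructure k μ) : IsCdgStructure k (embr T 1 μ) :=
  ⟨hT.isAInftyStructure_embr hμ h.1, hT.hasArityLT_embr ⟨h.1.1, hμ⟩ h.2⟩

end IsTwistedQuiver

end Structures

end TwistedObjects

theorem mainTheorem9 {k : Type*} [CommRing k] {Ob : Type*} {H : Ob → Ob → ℤ → Type*}
    [∀ A B d, AddCommGroup (H A B d)] [∀ A B d, Module k (H A B d)]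
    [∀ A B d, TopologicalSpace (H A B d)] [∀ A B d, IsTopologicalAddGroup (H A B d)]
    [∀ A B d, ContinuousConstSMul k (H A B d)] [∀ A B d, T2Space (H A B d)]
    (T : Set (TwObj H)) (hT : IsTwistedQuiver T k) :
    -- the series defining `embr_δ` converges pointwise to it
    (∀ (p : ℤ) (φ : RawCochain H), IsContCochain k p φ →
      PointwiseHasSum T (embrTerm T p φ) (embr T p φ)) ∧
    -- transport of `A_[0,∞[`-structures
    (∀ μ : RawCochain H, IsContinuous μ → IsAInftyStructure k μ →
      IsAInftyStructure k (embr T 1 μ) ∧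
      IsBInftyMorphism k (IsContCochain k) (IsCochain k) μ (embr T 1 μ) (embr T)) ∧
    -- the cdg case
    (∀ c d m : RawCochain H, HasArity 0 c → HasArity 1 d → HasArity 2 m →
      IsContinuous (c + d + m) → IsCdgStructure k (c + d + m) →
      embr T 1 (c + d + m)
        = (extend T 1 c + brace (extend T 1 d) (deltas T 1) + brace (extend T 1 m) (deltas T 2))
          + (extend T 1 d + brace (extend T 1 m) (deltas T 1)) + extend T 1 m ∧
      HasArity 0 (extend T 1 c + brace (extend T 1 d) (deltas T 1)
        + brace (extend T 1 m) (deltas T 2)) ∧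
      HasArity 1 (extend T 1 d + brace (extend T 1 m) (deltas T 1)) ∧
      HasArity 2 (extend T 1 m) ∧
      IsCdgStructure k (embr T 1 (c + d + m))) ∧
    -- the dg case
    (∀ d m : RawCochain H, HasArity 1 d → HasArity 2 m →
      IsContinuous (d + m) → IsDgStructure k (d + m) →
      brace (extend T 1 d) (deltas T 1) + brace (extend T 1 m) (deltas T 2) = 0 →
      embr T 1 (d + m)
        = (extend T 1 d + brace (extend T 1 m) (deltas T 1)) + extend T 1 m ∧
      IsDgStructure k (embr T 1 (d + m))) := by
  refine ⟨fun p φ hφ => hT.pointwiseHasSum hφ, fun μ hμ h =>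
    ⟨hT.isAInftyStructure_embr hμ h, hT.isBInftyMorphism_embr ⟨h.1, hμ⟩⟩, ?_, ?_⟩
  · intro c d m hc hd hm hμ h
    obtain ⟨hcc, hdc, hmc⟩ := isContCochain_components hc hd hm ⟨h.1.1, hμ⟩
    exact ⟨hT.embr_of_hasArity_le_two hcc hdc hmc hc hd hm,
      ((hc.extend hcc.1).add (hd.embrTerm hdc.1 rfl)).add (hm.embrTerm hmc.1 rfl),
      (hd.extend hdc.1).add (hm.embrTerm hmc.1 rfl), hm.extend hmc.1, hT.isCdgStructure_embr hμ h⟩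
  · intro d m hd hm hμ h hδ
    obtain ⟨-, hdc, hmc⟩ := isContCochain_components (c := 0) (fun _ _ _ _ => rfl) hd hm
      (by rw [zero_add]; exact ⟨h.1.1.1, hμ⟩)
    have hembr := hT.embr_of_curvature_eq_zero hdc hmc hd hm hδ
    refine ⟨hembr, hT.isCdgStructure_embr hμ h.1, fun M N q hq => ?_⟩
    rw [hembr]
    exact ((hd.extend hdc.1).add (hm.embrTerm hmc.1 rfl)).add_apply_eq_zero (hm.extend hmc.1)
      (by omega) (by omega)
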